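/- Let $c>0$ and let $\alpha\in(-\infty,-3/2)\cup\big([1/2,\infty)\setminus\mathbb N\big)$ be fixed. For $\nu\ge 0$ and $r>0$ let $$K_\nu(r)=\frac{\Gamma(\frac12)\,r^\nu}{2^\nu\,\Gamma(\nu+\frac12)}\int_1^\infty e^{-rx}(x^2-1)^{\nu-\frac12}\,dx$$ be the modified Bessel function of the second kind, with $K_{-\nu}=K_\nu$. Let $$\widehat{\phi_{\alpha,c}}(\xi)=\frac{2^{1+\alpha}}{\Gamma(-\alpha)}\Big(\frac{c}{|\xi|}\Big)^{\alpha+\frac12}K_{\alpha+\frac12}(c|\xi|),\qquad \xi\in\mathbb R\setminus\{0\},$$ which is the generalized Fourier transform of the general multiquadric $\phi_{\alpha,c}(x)=(x^2+c^2)^\alpha$. Define the fundamental function $L_{\alpha,c}$ on $\mathbb R$ by $$\widehat{L_{\alpha,c}}(\xi)=\frac{\widehat{\phi_{\alpha,c}}(\xi)}{\sum_{j\in\mathbb Z}\widehat{\phi_{\alpha,c}}(\xi+2\pi j)}\quad(\xi\in\mathbb R\setminus2\pi\mathbb Z),\qquad L_{\alpha,c}(x)=\frac1{2\pi}\int_{\mathbb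 R}\widehat{L_{\alpha,c}}(\xi)\,e^{ix\xi}\,d\xi .$$ Theorem. For every $1\le p\le\infty$, the cardinal interpolation operator $$\mathcal I_{\alpha,c}\mathbf y(x)=\sum_{j\in\mathbb Z}y_j\,L_{\alpha,c}(x-j),\qquad \mathbf y=(y_j)_{j\in\mathbb Z},\ x\in\mathbb R,$$ is a bounded linear operator from the complex sequence space $\ell_p(\mathbb Z)$ to the complex space $L_p(\mathbb R)$: for every $\mathbf y\in\ell_p(\mathbb Z)$ the series converges absolutely at every $x\in\mathbb R$, its sum belongs to $L_p(\mathbb R)$, and $\mathbf y\mapsto\mathcal I_{\alpha,c}\mathbf y$ is linear and bounded. -/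

import Mathlib

open MeasureTheory Set
open scoped ENNReal

noncomputable section

namespace CardinalInterpolation

/-- The modified Bessel function of the second kind `K_ν(r)`, for `r > 0`: for `ν ≥ 0` it is
`Γ(1/2) r^ν / (2^ν Γ(ν + 1/2)) ∫_1^∞ e^{-r x} (x² - 1)^{ν - 1/2} dx`, and it is extended to
negative orders by the symmetry `K_{-ν} = K_ν`. -/
def besselK (ν r : ℝ) : ℝ :=
  Real.Gamma (1 / 2) * r ^ |ν| / ((2 : ℝ) ^ |ν| * Real.Gamma (|ν| + 1 / 2)) *
    ∫ x in Ioi (1 : ℝ), Real.exp (-(r * x)) * (x ^ 2 - 1) ^ (|ν| - 1 / 2)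

/-- The generalized Fourier transform, away from the origin, of the univariate general multiquadric
`φ_{α,c}(x) = (x² + c²)^α`, where `c > 0` and `α` is not a nonnegative integer:
`2^{1+α} / Γ(-α) · (c / |ξ|)^{α + 1/2} · K_{α + 1/2}(c |ξ|)` for `ξ ≠ 0`.
The value at the single point `ξ = 0` plays no role below. -/
def multiquadricFT (α c ξ : ℝ) : ℝ :=
  (2 : ℝ) ^ (1 + α) / Real.Gamma (-α) * (c / |ξ|) ^ (α + 1 / 2) * besselK (α + 1 / 2) (c * |ξ|)

/-- The Fourier transform of the fundamental function:
`φ̂_{α,c}(ξ) / ∑_{j ∈ ℤ} φ̂_{α,c}(ξ + 2πj)` (meaningful off the null set `2πℤ`). -/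
def fundamentalFT (α c ξ : ℝ) : ℝ :=
  multiquadricFT α c ξ / ∑' j : ℤ, multiquadricFT α c (ξ + 2 * Real.pi * (j : ℝ))

/-- The fundamental (cardinal) function
`L_{α,c}(x) = (1 / 2π) ∫_ℝ L̂_{α,c}(ξ) e^{i x ξ} dξ`. -/
def fundamentalFunction (α c x : ℝ) : ℂ :=
  1 / (2 * (Real.pi : ℂ)) *
    ∫ ξ : ℝ, (fundamentalFT α c ξ : ℂ) * Complex.exp (Complex.I * (x : ℂ) * (ξ : ℂ))

/-- The cardinal interpolation operator `I_{α,c} y (x) = ∑_{j ∈ ℤ} y_j L_{α,c}(x - j)`. -/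
def cardinalInterpolant (α c : ℝ) (y : ℤ → ℂ) (x : ℝ) : ℂ :=
  ∑' j : ℤ, y j * fundamentalFunction α c (x - (j : ℝ))

end CardinalInterpolation

end

/-!
The operator is a discrete convolution with the kernel `L = L_{α,c}`. If `L` is continuous and
`|L(x)| ≤ C / (1 + x²)`, then both `∑_j |L(x - j)|` and `∫ |L|` are bounded, and Schur's test gives
absolute convergence and boundedness from `ℓ_p` to `L_p` for every `1 ≤ p ≤ ∞`
(`exists_continuousLinearMap_tsum_mul_shift`).

The decay of `L` comes from integrating its Fourier integral by parts twice
(`exists_norm_fourierIntegral_le`). It suffices that `L̂` is twice differentiable off `2πℤ`, that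
`L̂` and its first derivative extend continuously across `2πℤ`, and that `L̂` and its first two
derivatives are `O((1 + ξ²)⁻¹)`. Write `L̂ = f / ∑_j f(· + 2πj)` with `f` proportional to the transform of the
multiquadric. Away from `2πℤ` everything is smooth, and near the origin
`L̂ = 1 / (1 + f⁻¹ S)`, where `S` collects the terms `j ≠ 0` and is regular there. So the only
delicate point is the regularity of `1 / f` at the origin, and the class `IsCardinalSymbol` isolates
it.

Put `M_a(r) = ∫_1^∞ e^{-r x} (x² - 1)^a dx`, which is of the order of `r^{-(2a+1)}` near `0`.

* For `α ≥ 1/2` one has `f(ξ) = M_α(c|ξ|)`, and `1 / f` vanishes to order `2α + 1 ≥ 2` at the origin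
  (`isCardinalSymbol_besselMoment`).
* For `α < -3/2` one has, with `a = -α - 1 > 1/2`, `f(ξ) = H(c|ξ|)` where `H(r) = r^{2a+1} M_a(r)`.
  Here a crude estimate of `H'` only gives `O(1/r)`; the recurrence `besselMoment_recurrence` shows
  the cancellation `H'(r) = -2a r^{2a} M_{a-1}(r) = O(r)`, and a crude estimate of `H''` then
  suffices (`isCardinalSymbol_rpow_mul_besselMoment`).
-/

namespace CardinalInterpolation

open Filter Topology

/-! ### Moments of the Bessel integral -/

/-- The moment `∫_1^∞ x^k e^{-r x} (x² - 1)^a dx`. For `a = ν - 1/2` and `k = 0` it is the integral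
in the definition of `K_ν`, and increasing `k` by one amounts to taking `-d/dr`. -/
noncomputable def besselMoment (a : ℝ) (k : ℕ) (r : ℝ) : ℝ :=
  ∫ x in Ioi (1 : ℝ), x ^ k * (Real.exp (-(r * x)) * (x ^ 2 - 1) ^ a)

theorem integrableOn_rpow_mul_exp_Ioi {s r : ℝ} (hs : -1 < s) (hr : 0 < r) :
    IntegrableOn (fun x : ℝ => x ^ s * Real.exp (-(r * x))) (Ioi 0) := by
  have h := integrableOn_rpow_mul_exp_neg_mul_rpow hs one_pos hr
  simpa [Real.rpow_one, neg_mul] using h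

theorem integral_rpow_mul_exp_Ioi {s r : ℝ} (hs : -1 < s) (hr : 0 < r) :
    ∫ x in Ioi (0 : ℝ), x ^ s * Real.exp (-(r * x)) = Real.Gamma (s + 1) * r ^ (-(s + 1)) := by
  have h := Real.integral_rpow_mul_exp_neg_mul_Ioi (a := s + 1) (by linarith) hr
  rw [add_sub_cancel_right] at h
  rw [h, one_div, Real.inv_rpow hr.le, Real.rpow_neg hr.le, mul_comm]

/-- A majorant of the integrand of `besselMoment a k r`: the first summand serves `0 ≤ a`, the
second one serves `a < 0`, where the weight is singular at `1`. -/
noncomputable def besselMajorant (a : ℝ) (k : ℕ) (r x : ℝ) : ℝ :=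
  x ^ (2 * a + k) * Real.exp (-(r * x)) +
    2 ^ k * ((x - 1) ^ (2 * a) * Real.exp (-(r * (x - 1))) +
      (x - 1) ^ (2 * a + k) * Real.exp (-(r * (x - 1))))

theorem besselIntegrand_nonneg {a : ℝ} {k : ℕ} {r x : ℝ} (hx : 1 < x) :
    0 ≤ x ^ k * (Real.exp (-(r * x)) * (x ^ 2 - 1) ^ a) := by
  have : 0 ≤ x ^ 2 - 1 := by nlinarith
  positivity

theorem besselIntegrand_le_majorant {a : ℝ} {k : ℕ} {r x : ℝ} (hr : 0 < r) (hx : 1 < x) :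
    x ^ k * (Real.exp (-(r * x)) * (x ^ 2 - 1) ^ a) ≤ besselMajorant a k r x := by
  have hx0 : 0 < x := by linarith
  have ht : 0 < x - 1 := by linarith
  have hw : 0 < x ^ 2 - 1 := by nlinarith
  have hA : 0 ≤ x ^ (2 * a + k) * Real.exp (-(r * x)) := by positivity
  have hB : 0 ≤ (2 : ℝ) ^ k * ((x - 1) ^ (2 * a) * Real.exp (-(r * (x - 1))) +
      (x - 1) ^ (2 * a + k) * Real.exp (-(r * (x - 1)))) := by positivity
  unfold besselMajorant
  rcases le_or_gt 0 a with ha | ha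
  · have h1 : (x ^ 2 - 1) ^ a ≤ x ^ (2 * a) := by
      rw [Real.rpow_mul hx0.le, Real.rpow_two]
      exact Real.rpow_le_rpow hw.le (by linarith) ha
    have h2 : x ^ k * (Real.exp (-(r * x)) * (x ^ 2 - 1) ^ a)
        ≤ x ^ (2 * a + k) * Real.exp (-(r * x)) := by
      rw [Real.rpow_add hx0, Real.rpow_natCast]
      calc _ ≤ x ^ k * (Real.exp (-(r * x)) * x ^ (2 * a)) := by gcongr
        _ = _ := by ring
    linarith
  · have h1 : (x ^ 2 - 1) ^ a ≤ (x - 1) ^ (2 * a) := by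
      rw [Real.rpow_mul ht.le, Real.rpow_two]
      exact Real.rpow_le_rpow_of_nonpos (by positivity) (by nlinarith) ha.le
    have h3 : x ^ k ≤ 2 ^ k * (1 + (x - 1) ^ k) := by
      rcases le_total x 2 with h | h
      · calc x ^ k ≤ 2 ^ k := by gcongr
          _ ≤ _ := by
            have : 0 ≤ (x - 1) ^ k := by positivity
            nlinarith [pow_pos (two_pos : (0 : ℝ) < 2) k]
      · calc x ^ k ≤ (2 * (x - 1)) ^ k := by gcongr; linarith
          _ = 2 ^ k * (x - 1) ^ k := by rw [mul_pow]
          _ ≤ _ := by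
            have := pow_pos (two_pos : (0 : ℝ) < 2) k
            nlinarith
    have h4 : Real.exp (-(r * x)) ≤ Real.exp (-(r * (x - 1))) := by
      apply Real.exp_le_exp.2; nlinarith
    have h2 : x ^ k * (Real.exp (-(r * x)) * (x ^ 2 - 1) ^ a)
        ≤ 2 ^ k * ((x - 1) ^ (2 * a) * Real.exp (-(r * (x - 1))) +
      (x - 1) ^ (2 * a + k) * Real.exp (-(r * (x - 1)))) := by
      rw [Real.rpow_add ht, Real.rpow_natCast]
      calc _ ≤ (2 ^ k * (1 + (x - 1) ^ k)) *
            (Real.exp (-(r * (x - 1))) * (x - 1) ^ (2 * a)) := by gcongr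
        _ = _ := by ring
    linarith

theorem integrableOn_comp_sub_one {f : ℝ → ℝ} (hf : IntegrableOn f (Ioi 0)) :
    IntegrableOn (fun x => f (x - 1)) (Ioi 1) := by
  have h := ((measurePreserving_sub_right volume (1 : ℝ)).integrableOn_comp_preimage
    (measurableEmbedding_subRight 1) (f := f) (s := Ioi 0)).2 hf
  simpa using! h

theorem integral_comp_sub_one (f : ℝ → ℝ) :
    ∫ x in Ioi (1 : ℝ), f (x - 1) = ∫ x in Ioi (0 : ℝ), f x := by
  have h := (measurePreserving_sub_right volume (1 : ℝ)).setIntegral_preimage_emb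
    (measurableEmbedding_subRight 1) f (Ioi 0)
  simpa using h

theorem integrableOn_besselMajorant {a : ℝ} (ha : -(1 / 2) < a) (k : ℕ) {r : ℝ} (hr : 0 < r) :
    IntegrableOn (besselMajorant a k r) (Ioi 1) := by
  have hk : (0 : ℝ) ≤ k := k.cast_nonneg
  refine ((integrableOn_rpow_mul_exp_Ioi (s := 2 * a + k) (by linarith) hr).mono_set
    (Ioi_subset_Ioi zero_le_one)).add (Integrable.const_mul (Integrable.add ?_ ?_) _)
  · exact integrableOn_comp_sub_one
      (integrableOn_rpow_mul_exp_Ioi (s := 2 * a) (by linarith) hr)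
  · exact integrableOn_comp_sub_one
      (integrableOn_rpow_mul_exp_Ioi (s := 2 * a + k) (by linarith) hr)

theorem measurable_besselIntegrand (a : ℝ) (k : ℕ) (r : ℝ) :
    Measurable fun x : ℝ => x ^ k * (Real.exp (-(r * x)) * (x ^ 2 - 1) ^ a) := by fun_prop

theorem integrableOn_besselIntegrand {a : ℝ} (ha : -(1 / 2) < a) (k : ℕ) {r : ℝ} (hr : 0 < r) :
    IntegrableOn (fun x : ℝ => x ^ k * (Real.exp (-(r * x)) * (x ^ 2 - 1) ^ a)) (Ioi 1) := by
  refine (integrableOn_besselMajorant ha k hr).mono'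
    (measurable_besselIntegrand a k r).aestronglyMeasurable ?_
  filter_upwards [ae_restrict_mem measurableSet_Ioi] with x hx
  rw [Real.norm_of_nonneg (besselIntegrand_nonneg hx)]
  exact besselIntegrand_le_majorant hr hx

theorem besselMoment_nonneg (a : ℝ) (k : ℕ) (r : ℝ) : 0 ≤ besselMoment a k r :=
  setIntegral_nonneg measurableSet_Ioi fun _ hx => besselIntegrand_nonneg hx

theorem besselMoment_pos {a : ℝ} (ha : -(1 / 2) < a) (k : ℕ) {r : ℝ} (hr : 0 < r) :
    0 < besselMoment a k r := by
  rw [besselMoment, setIntegral_pos_iff_support_of_nonneg_ae]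
  · refine lt_of_lt_of_le ?_ (measure_mono (s := Ioi (1 : ℝ)) ?_)
    · simp
    · intro x hx
      refine ⟨?_, hx⟩
      have hx : 1 < x := hx
      have : 0 < x ^ 2 - 1 := by nlinarith
      exact (by positivity : 0 < x ^ k * (Real.exp (-(r * x)) * (x ^ 2 - 1) ^ a)).ne'
  · filter_upwards [ae_restrict_mem measurableSet_Ioi] with x hx
    exact besselIntegrand_nonneg hx
  · exact integrableOn_besselIntegrand ha k hr

theorem hasDerivAt_besselMoment {a : ℝ} (ha : -(1 / 2) < a) (k : ℕ) {r : ℝ} (hr : 0 < r) :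
    HasDerivAt (besselMoment a k) (-besselMoment a (k + 1) r) r := by
  have h := hasDerivAt_integral_of_dominated_loc_of_deriv_le (μ := volume.restrict (Ioi (1 : ℝ)))
    (F := fun r x => x ^ k * (Real.exp (-(r * x)) * (x ^ 2 - 1) ^ a))
    (F' := fun r x => -(x ^ (k + 1) * (Real.exp (-(r * x)) * (x ^ 2 - 1) ^ a)))
    (x₀ := r) (s := Ioi (r / 2)) (Ioi_mem_nhds (by linarith))
    (bound := fun x => x ^ (k + 1) * (Real.exp (-(r / 2 * x)) * (x ^ 2 - 1) ^ a))
    (Eventually.of_forall fun s => (measurable_besselIntegrand a k s).aestronglyMeasurable)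
    (integrableOn_besselIntegrand ha k hr)
    ((measurable_besselIntegrand a (k + 1) r).neg.aestronglyMeasurable) ?_
    (integrableOn_besselIntegrand ha (k + 1) (by linarith)) ?_
  · have h2 := h.2
    rw [integral_neg] at h2
    exact h2
  · filter_upwards [ae_restrict_mem measurableSet_Ioi] with x hx s hs
    have hx : 1 < x := hx
    have hs : r / 2 < s := hs
    rw [norm_neg, Real.norm_of_nonneg (besselIntegrand_nonneg hx)]
    have : 0 ≤ x ^ 2 - 1 := by nlinarith
    gcongr
  · refine Eventually.of_forall fun x s _ => ?_
    have h1 : HasDerivAt (fun s : ℝ => -(s * x)) (-x) s := by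
      simpa using! ((hasDerivAt_id s).mul_const x).neg
    convert! ((h1.exp.mul_const ((x ^ 2 - 1) ^ a)).const_mul (x ^ k)) using 1
    ring

/-- `K_ν(r) = O(r^{-ν})` as `r → 0`, together with the corresponding bounds for its derivatives. -/
theorem besselMoment_le_of_le_one {a : ℝ} (ha : -(1 / 2) < a) (k : ℕ) :
    ∃ C : ℝ, 0 < C ∧ ∀ r : ℝ, 0 < r → r ≤ 1 → besselMoment a k r ≤ C * r ^ (-(2 * a + k + 1)) := by
  have hk : (0 : ℝ) ≤ k := k.cast_nonneg
  have g1 : 0 < Real.Gamma (2 * a + k + 1) := Real.Gamma_pos_of_pos (by linarith)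
  have g2 : 0 < Real.Gamma (2 * a + 1) := Real.Gamma_pos_of_pos (by linarith)
  refine ⟨Real.Gamma (2 * a + k + 1) +
    2 ^ k * (Real.Gamma (2 * a + 1) + Real.Gamma (2 * a + k + 1)), by positivity, ?_⟩
  intro r hr hr1
  have hs1 : -1 < 2 * a + k := by linarith
  have hs2 : -1 < 2 * a := by linarith
  have i1 := integrableOn_rpow_mul_exp_Ioi hs1 hr
  have i2 := integrableOn_rpow_mul_exp_Ioi hs2 hr
  have hle : besselMoment a k r ≤ ∫ x in Ioi (1 : ℝ), besselMajorant a k r x :=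
    setIntegral_mono_on (integrableOn_besselIntegrand ha k hr)
      (integrableOn_besselMajorant ha k hr) measurableSet_Ioi
      fun x hx => besselIntegrand_le_majorant hr hx
  have hadd : ∫ x in Ioi (1 : ℝ), besselMajorant a k r x =
      (∫ x in Ioi (1 : ℝ), x ^ (2 * a + k) * Real.exp (-(r * x))) +
      2 ^ k * ((∫ x in Ioi (0 : ℝ), x ^ (2 * a) * Real.exp (-(r * x))) +
        ∫ x in Ioi (0 : ℝ), x ^ (2 * a + k) * Real.exp (-(r * x))) := by
    rw [← integral_comp_sub_one, ← integral_comp_sub_one, ← integral_add, ← integral_const_mul,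
      ← integral_add]
    · rfl
    · exact i1.mono_set (Ioi_subset_Ioi zero_le_one)
    · exact ((integrableOn_comp_sub_one i2).add (integrableOn_comp_sub_one i1)).const_mul _
    · exact integrableOn_comp_sub_one i2
    · exact integrableOn_comp_sub_one i1
  have hfirst : (∫ x in Ioi (1 : ℝ), x ^ (2 * a + k) * Real.exp (-(r * x))) ≤
      ∫ x in Ioi (0 : ℝ), x ^ (2 * a + k) * Real.exp (-(r * x)) := by
    refine setIntegral_mono_set i1 ?_ (Ioi_subset_Ioi zero_le_one).eventuallyLE
    filter_upwards [ae_restrict_mem measurableSet_Ioi] with x hx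
    have hx : 0 < x := hx
    simp only [Pi.zero_apply]
    positivity
  rw [integral_rpow_mul_exp_Ioi hs1 hr] at hadd hfirst
  rw [integral_rpow_mul_exp_Ioi hs2 hr] at hadd
  have hpow : r ^ (-(2 * a + 1)) ≤ r ^ (-(2 * a + k + 1)) :=
    Real.rpow_le_rpow_of_exponent_ge hr hr1 (by linarith)
  calc besselMoment a k r ≤ _ := hle
    _ = _ := hadd
    _ ≤ Real.Gamma (2 * a + k + 1) * r ^ (-(2 * a + k + 1)) + 2 ^ k *
        (Real.Gamma (2 * a + 1) * r ^ (-(2 * a + k + 1)) +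
        Real.Gamma (2 * a + k + 1) * r ^ (-(2 * a + k + 1))) := by gcongr
    _ = _ := by ring

/-- On `2/r < x ≤ 3/r` the exponential is at least `e^{-3}` and `x² - 1` is at least `r^{-2}`. -/
theorem le_besselMoment_zero_of_le_one {a : ℝ} (ha : 0 ≤ a) {r : ℝ} (hr : 0 < r) (hr1 : r ≤ 1) :
    Real.exp (-3) * r ^ (-(2 * a + 1)) ≤ besselMoment a 0 r := by
  have hint := integrableOn_besselIntegrand (a := a) (by linarith) 0 hr
  have hsub : Ioc (2 / r) (3 / r) ⊆ Ioi (1 : ℝ) := by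
    intro x hx
    have : 1 ≤ 1 / r := by rw [le_div_iff₀ hr]; linarith
    have h2 : 2 / r = 2 * (1 / r) := by ring
    have := hx.1
    exact (by linarith : 1 < x)
  have h1 : ∫ _ in Ioc (2 / r) (3 / r), Real.exp (-3) * (1 / r) ^ (2 * a) ≤
      ∫ x in Ioc (2 / r) (3 / r), x ^ 0 * (Real.exp (-(r * x)) * (x ^ 2 - 1) ^ a) := by
    refine setIntegral_mono_on (integrableOn_const (by simp)) (hint.mono_set hsub)
      measurableSet_Ioc fun x hx => ?_
    have hx1 : 2 / r < x := hx.1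
    have hx2 : x ≤ 3 / r := hx.2
    rw [le_div_iff₀ hr] at hx2
    have hr' : 1 ≤ 1 / r := by rw [le_div_iff₀ hr]; linarith
    have h2 : 2 / r = 2 * (1 / r) := by ring
    rw [pow_zero, one_mul, Real.rpow_mul (by positivity), Real.rpow_two]
    gcongr
    · linarith
    · nlinarith
  calc Real.exp (-3) * r ^ (-(2 * a + 1))
      = ∫ _ in Ioc (2 / r) (3 / r), Real.exp (-3) * (1 / r) ^ (2 * a) := by
        rw [setIntegral_const, smul_eq_mul, Real.volume_real_Ioc_of_le (by gcongr; norm_num),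
          one_div, Real.inv_rpow hr.le, ← Real.rpow_neg hr.le,
          show -(2 * a + 1) = -(2 * a) + -1 by ring, Real.rpow_add hr, Real.rpow_neg_one]
        ring
    _ ≤ _ := h1
    _ ≤ besselMoment a 0 r := by
      refine setIntegral_mono_set hint ?_ hsub.eventuallyLE
      filter_upwards [ae_restrict_mem measurableSet_Ioi] with x hx
      exact besselIntegrand_nonneg hx

/-- Exponential decay of the moments away from the origin. -/
theorem besselMoment_le_exp {a : ℝ} (ha : -(1 / 2) < a) (k : ℕ) {d r : ℝ} (hd : 0 < d)
    (hr : d ≤ r) : besselMoment a k r ≤ besselMoment a k (d / 2) * Real.exp (-(r / 2)) := by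
  rw [besselMoment, besselMoment, ← integral_mul_const]
  refine setIntegral_mono_on (integrableOn_besselIntegrand ha k (hd.trans_le hr))
    ((integrableOn_besselIntegrand ha k (by linarith)).mul_const _) measurableSet_Ioi fun x hx => ?_
  have hx : 1 < x := hx
  have hw : 0 ≤ x ^ 2 - 1 := by nlinarith
  have h : Real.exp (-(r * x)) ≤ Real.exp (-(d / 2 * x)) * Real.exp (-(r / 2)) := by
    rw [← Real.exp_add]
    apply Real.exp_le_exp.2
    nlinarith
  calc _ ≤ x ^ k * ((Real.exp (-(d / 2 * x)) * Real.exp (-(r / 2))) * (x ^ 2 - 1) ^ a) := by gcongr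
    _ = _ := by ring

/-- The recurrence behind `(r^ν K_ν(r))' = -r^ν K_{ν-1}(r)`, obtained by integrating the derivative
of `e^{-r x} x (x² - 1)^a` over `(1, ∞)`. -/
theorem besselMoment_recurrence {a : ℝ} (ha : 1 / 2 < a) {r : ℝ} (hr : 0 < r) :
    r * besselMoment a 1 r =
      (2 * a + 1) * besselMoment a 0 r + 2 * a * besselMoment (a - 1) 0 r := by
  have i1 := integrableOn_besselIntegrand (a := a) (by linarith) 1 hr
  have i0 := integrableOn_besselIntegrand (a := a) (by linarith) 0 hr
  have j0 := integrableOn_besselIntegrand (a := a - 1) (by linarith) 0 hr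
  have key := integral_Ioi_of_hasDerivAt_of_tendsto (a := (1 : ℝ)) (m := 0)
    (f := fun x => x * (Real.exp (-(r * x)) * (x ^ 2 - 1) ^ a)) (E := ℝ)
    (f' := fun x => (2 * a + 1) * (x ^ 0 * (Real.exp (-(r * x)) * (x ^ 2 - 1) ^ a)) +
      2 * a * (x ^ 0 * (Real.exp (-(r * x)) * (x ^ 2 - 1) ^ (a - 1))) -
      r * (x ^ 1 * (Real.exp (-(r * x)) * (x ^ 2 - 1) ^ a))) ?_ ?_ ?_ ?_
  · rw [integral_sub, integral_add, integral_const_mul, integral_const_mul, integral_const_mul]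
      at key
    · have h0 : ((1 : ℝ) ^ 2 - 1) ^ a = 0 := by
        rw [one_pow, sub_self, Real.zero_rpow (by linarith)]
      rw [h0] at key
      simp only [besselMoment]
      linarith
    · exact i0.const_mul _
    · exact j0.const_mul _
    · exact (i0.const_mul (2 * a + 1)).add (j0.const_mul (2 * a))
    · exact i1.const_mul _
  · refine ContinuousAt.continuousWithinAt ?_
    refine continuousAt_id.mul (ContinuousAt.mul (by fun_prop) ?_)
    exact ContinuousAt.rpow_const (by fun_prop) (Or.inr (by linarith))
  · intro x hx
    have hx : 1 < x := hx
    have hw : 0 < x ^ 2 - 1 := by nlinarith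
    have h1 : HasDerivAt (fun x : ℝ => Real.exp (-(r * x))) (Real.exp (-(r * x)) * (-r)) x := by
      simpa using (((hasDerivAt_id x).const_mul r).neg).exp
    have h2 : HasDerivAt (fun x : ℝ => (x ^ 2 - 1) ^ a)
        (2 * x * a * (x ^ 2 - 1) ^ (a - 1)) x := by
      have : HasDerivAt (fun x : ℝ => x ^ 2 - 1) (2 * x) x := by
        simpa using (hasDerivAt_pow 2 x).sub_const 1
      exact this.rpow_const (Or.inl hw.ne')
    convert! (hasDerivAt_id x).mul (h1.mul h2) using 1
    have h3 : (x ^ 2 - 1) ^ a = (x ^ 2 - 1) * (x ^ 2 - 1) ^ (a - 1) := by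
      rw [Real.rpow_sub_one hw.ne']; field_simp
    simp only [id, Pi.mul_apply, h3]
    ring
  · exact ((i0.const_mul (2 * a + 1)).add (j0.const_mul (2 * a))).sub (i1.const_mul r)
  · have hk : Tendsto (fun x : ℝ => x ^ (2 * a + 1) * Real.exp (-r * x)) atTop (𝓝 0) :=
      tendsto_rpow_mul_exp_neg_mul_atTop_nhds_zero _ _ hr
    refine squeeze_zero' ?_ ?_ hk
    · filter_upwards [eventually_gt_atTop 1] with x hx
      simpa using besselIntegrand_nonneg (a := a) (k := 1) (r := r) hx
    · filter_upwards [eventually_gt_atTop 1] with x hx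
      have hx0 : 0 < x := by linarith
      have hw : 0 ≤ x ^ 2 - 1 := by nlinarith
      have h1 : (x ^ 2 - 1) ^ a ≤ x ^ (2 * a) := by
        rw [Real.rpow_mul hx0.le, Real.rpow_two]
        exact Real.rpow_le_rpow hw (by linarith) (by linarith)
      rw [Real.rpow_add_one hx0.ne', neg_mul]
      calc _ ≤ x * (Real.exp (-(r * x)) * x ^ (2 * a)) := by gcongr
        _ = _ := by ring

theorem contDiffOn_besselMoment {a : ℝ} (ha : -(1 / 2) < a) (n k : ℕ) :
    ContDiffOn ℝ n (besselMoment a k) (Ioi 0) := by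
  induction n generalizing k with
  | zero =>
    rw [Nat.cast_zero, contDiffOn_zero]
    exact fun r hr => (hasDerivAt_besselMoment ha k hr).continuousAt.continuousWithinAt
  | succ n ih =>
    rw [Nat.cast_succ, contDiffOn_succ_iff_deriv_of_isOpen isOpen_Ioi]
    refine ⟨fun r hr => (hasDerivAt_besselMoment ha k hr).differentiableAt.differentiableWithinAt,
      fun h => ?_, ?_⟩
    · simp at h
    · exact (ih (k + 1)).neg.congr fun r hr => (hasDerivAt_besselMoment ha k hr).deriv

/-! ### Functions with bounded second derivative off a closed countable set -/

/-- Along `A`, the function `u` behaves near `x` like a function with bounded second derivative: it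
is twice differentiable at the points of `A` near `x`, its second derivative is bounded there, and
`u` and `u'` have limits at `x` along `A`. The value of `u` at `x` itself is irrelevant when
`x ∉ A`. For open `A` this is stable under products and reciprocals. -/
structure IsRegularAlong (A : Set ℝ) (u : ℝ → ℝ) (x : ℝ) : Prop where
  differentiableAt : ∀ᶠ y in 𝓝[A] x, DifferentiableAt ℝ u y
  differentiableAt_deriv : ∀ᶠ y in 𝓝[A] x, DifferentiableAt ℝ (deriv u) y
  exists_tendsto : ∃ a, Tendsto u (𝓝[A] x) (𝓝 a)
  exists_tendsto_deriv : ∃ b, Tendsto (deriv u) (𝓝[A] x) (𝓝 b)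
  isBigO_deriv2 : deriv (deriv u) =O[𝓝[A] x] (fun _ => (1 : ℝ))

theorem eventually_eventually_nhds_of_isOpen {A : Set ℝ} (hA : IsOpen A) {x : ℝ} {p : ℝ → Prop}
    (h : ∀ᶠ y in 𝓝[A] x, p y) : ∀ᶠ y in 𝓝[A] x, ∀ᶠ z in 𝓝 y, p z := by
  filter_upwards [eventually_eventually_nhdsWithin.2 h, self_mem_nhdsWithin] with y hy hyA
  rwa [hA.nhdsWithin_eq hyA] at hy

namespace IsRegularAlong

variable {A : Set ℝ} {u v : ℝ → ℝ} {x : ℝ}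

theorem of_hasDerivAt (hA : IsOpen A) {D E : ℝ → ℝ} {a b : ℝ}
    (hD : ∀ᶠ y in 𝓝[A] x, HasDerivAt u (D y) y) (hE : ∀ᶠ y in 𝓝[A] x, HasDerivAt D (E y) y)
    (ha : Tendsto u (𝓝[A] x) (𝓝 a)) (hb : Tendsto D (𝓝[A] x) (𝓝 b))
    (hM : E =O[𝓝[A] x] (fun _ => (1 : ℝ))) : IsRegularAlong A u x := by
  have h1 : deriv u =ᶠ[𝓝[A] x] D := hD.mono fun y hy => hy.deriv
  have h2 : ∀ᶠ y in 𝓝[A] x, deriv u =ᶠ[𝓝 y] D := eventually_eventually_nhds_of_isOpen hA h1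
  have h3 : ∀ᶠ y in 𝓝[A] x, HasDerivAt (deriv u) (E y) y := by
    filter_upwards [h2, hE] with y hy hEy using hEy.congr_of_eventuallyEq hy
  refine ⟨hD.mono fun y hy => hy.differentiableAt, h3.mono fun y hy => hy.differentiableAt,
    ⟨a, ha⟩, ⟨b, hb.congr' h1.symm⟩, hM.congr' ?_ EventuallyEq.rfl⟩
  exact (h3.mono fun y hy => hy.deriv.symm)

theorem congr (hA : IsOpen A) (h : IsRegularAlong A u x) (huv : u =ᶠ[𝓝[A] x] v) :
    IsRegularAlong A v x := by
  obtain ⟨a, ha⟩ := h.exists_tendsto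
  obtain ⟨b, hb⟩ := h.exists_tendsto_deriv
  refine of_hasDerivAt hA ?_ ?_ (ha.congr' huv) hb h.isBigO_deriv2
  · filter_upwards [h.differentiableAt, eventually_eventually_nhds_of_isOpen hA huv] with y hy hy2
    exact hy.hasDerivAt.congr_of_eventuallyEq (EventuallyEq.symm hy2)
  · exact h.differentiableAt_deriv.mono fun y hy => hy.hasDerivAt

theorem mono {B : Set ℝ} (h : IsRegularAlong A u x) (hBA : B ⊆ A) : IsRegularAlong B u x := by
  have hle := nhdsWithin_mono x hBA
  obtain ⟨a, ha⟩ := h.exists_tendsto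
  obtain ⟨b, hb⟩ := h.exists_tendsto_deriv
  exact ⟨h.differentiableAt.filter_mono hle, h.differentiableAt_deriv.filter_mono hle,
    ⟨a, ha.mono_left hle⟩, ⟨b, hb.mono_left hle⟩, h.isBigO_deriv2.mono hle⟩

theorem mul (hA : IsOpen A) (hu : IsRegularAlong A u x) (hv : IsRegularAlong A v x) :
    IsRegularAlong A (fun y => u y * v y) x := by
  obtain ⟨a, ha⟩ := hu.exists_tendsto
  obtain ⟨b, hb⟩ := hu.exists_tendsto_deriv
  obtain ⟨a', ha'⟩ := hv.exists_tendsto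
  obtain ⟨b', hb'⟩ := hv.exists_tendsto_deriv
  refine of_hasDerivAt hA (D := fun y => deriv u y * v y + u y * deriv v y)
    (E := fun y => (deriv (deriv u) y * v y + deriv u y * deriv v y) +
      (deriv u y * deriv v y + u y * deriv (deriv v) y)) ?_ ?_ (ha.mul ha')
      ((hb.mul ha').add (ha.mul hb')) ?_
  · filter_upwards [hu.differentiableAt, hv.differentiableAt] with y h1 h2
    exact h1.hasDerivAt.mul h2.hasDerivAt
  · filter_upwards [hu.differentiableAt, hv.differentiableAt, hu.differentiableAt_deriv,
      hv.differentiableAt_deriv] with y h1 h2 h3 h4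
    exact (h3.hasDerivAt.mul h2.hasDerivAt).add (h1.hasDerivAt.mul h4.hasDerivAt)
  · have o0 := ha.isBigO_one ℝ
    have o1 := hb.isBigO_one ℝ
    have o0' := ha'.isBigO_one ℝ
    have o1' := hb'.isBigO_one ℝ
    have key := ((hu.isBigO_deriv2.mul o0').add (o1.mul o1')).add
      ((o1.mul o1').add (o0.mul hv.isBigO_deriv2))
    simpa using key

theorem const_add (hA : IsOpen A) (c : ℝ) (hu : IsRegularAlong A u x) :
    IsRegularAlong A (fun y => c + u y) x := by
  obtain ⟨a, ha⟩ := hu.exists_tendsto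
  obtain ⟨b, hb⟩ := hu.exists_tendsto_deriv
  refine of_hasDerivAt hA ?_ ?_ (ha.const_add c) hb hu.isBigO_deriv2
  · exact hu.differentiableAt.mono fun y hy => hy.hasDerivAt.const_add c
  · exact hu.differentiableAt_deriv.mono fun y hy => hy.hasDerivAt

theorem inv (hA : IsOpen A) (hu : IsRegularAlong A u x) {a : ℝ} (ha : Tendsto u (𝓝[A] x) (𝓝 a))
    (ha0 : a ≠ 0) : IsRegularAlong A (fun y => (u y)⁻¹) x := by
  obtain ⟨b, hb⟩ := hu.exists_tendsto_deriv
  have hne : ∀ᶠ y in 𝓝[A] x, u y ≠ 0 := ha.eventually_ne ha0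
  have hi := ha.inv₀ ha0
  refine of_hasDerivAt hA (D := fun y => -deriv u y * ((u y)⁻¹ * (u y)⁻¹))
    (E := fun y => -deriv (deriv u) y * ((u y)⁻¹ * (u y)⁻¹) +
      2 * (deriv u y * deriv u y) * ((u y)⁻¹ * (u y)⁻¹ * (u y)⁻¹)) ?_ ?_ hi
      (hb.neg.mul (hi.mul hi)) ?_
  · filter_upwards [hu.differentiableAt, hne] with y h1 h2
    convert! h1.hasDerivAt.inv h2 using 1
    field_simp
  · filter_upwards [hu.differentiableAt, hu.differentiableAt_deriv, hne] with y h1 h2 h3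
    have h4 := h1.hasDerivAt.inv h3
    convert! h2.hasDerivAt.neg.mul (h4.mul h4) using 1
    simp only [Pi.mul_apply, Pi.inv_apply, Pi.neg_apply]
    field_simp
    ring
  · have o0 := hi.isBigO_one ℝ
    have o1 := hb.isBigO_one ℝ
    have k1 := hu.isBigO_deriv2.neg_left.mul (o0.mul o0)
    have k2 := ((o1.mul o1).const_mul_left 2).mul ((o0.mul o0).mul o0)
    simp only [mul_one] at k1 k2
    exact k1.add k2

theorem of_contDiffOn (hA : IsOpen A) {U : Set ℝ} (hU : IsOpen U) (h : ContDiffOn ℝ 2 u U)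
    (hx : x ∈ U) : IsRegularAlong A u x := by
  have hn : U ∈ 𝓝 x := hU.mem_nhds hx
  have h1 : ContDiffOn ℝ 1 (deriv u) U :=
    ((contDiffOn_succ_iff_deriv_of_isOpen (n := 1) hU).1 h).2.2
  have h2 : ContDiffOn ℝ 0 (deriv (deriv u)) U :=
    ((contDiffOn_succ_iff_deriv_of_isOpen (n := 0) hU).1 h1).2.2
  have d0 : ∀ y ∈ U, DifferentiableAt ℝ u y := fun y hy =>
    (h.differentiableOn (by norm_num)).differentiableAt (hU.mem_nhds hy)
  have d1 : ∀ y ∈ U, DifferentiableAt ℝ (deriv u) y := fun y hy =>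
    (h1.differentiableOn (by norm_num)).differentiableAt (hU.mem_nhds hy)
  have hle : 𝓝[A] x ≤ 𝓝 x := nhdsWithin_le_nhds
  refine of_hasDerivAt hA (D := deriv u) (E := deriv (deriv u))
    ((eventually_of_mem hn fun y hy => (d0 y hy).hasDerivAt).filter_mono hle)
    ((eventually_of_mem hn fun y hy => (d1 y hy).hasDerivAt).filter_mono hle)
    ((d0 x hx).continuousAt.tendsto.mono_left hle)
    ((d1 x hx).continuousAt.tendsto.mono_left hle)
    (((h2.continuousOn.continuousAt hn).tendsto.mono_left hle).isBigO_one ℝ)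

theorem comp_add_const {T : ℝ} (hAT : ∀ y ∈ A, y + T ∈ A)
    (h : IsRegularAlong A u (x + T)) : IsRegularAlong A (fun y => u (y + T)) x := by
  have ht : Tendsto (fun y => y + T) (𝓝[A] x) (𝓝[A] (x + T)) :=
    ((continuous_add_const T).tendsto x).inf (tendsto_principal_principal.2 hAT)
  have hd : deriv (fun y => u (y + T)) = fun y => deriv u (y + T) :=
    funext fun y => deriv_comp_add_const u T y
  have hd2 : deriv (fun y => deriv u (y + T)) = fun y => deriv (deriv u) (y + T) :=
    funext fun y => deriv_comp_add_const (deriv u) T y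
  obtain ⟨a, ha⟩ := h.exists_tendsto
  obtain ⟨b, hb⟩ := h.exists_tendsto_deriv
  refine ⟨?_, ?_, ⟨a, ha.comp ht⟩, ⟨b, ?_⟩, ?_⟩
  · exact (ht.eventually h.differentiableAt).mono fun y hy =>
      (hy.hasDerivAt.comp_add_const y T).differentiableAt
  · rw [hd]
    exact (ht.eventually h.differentiableAt_deriv).mono fun y hy =>
      (hy.hasDerivAt.comp_add_const y T).differentiableAt
  · rw [hd]; exact hb.comp ht
  · rw [hd, hd2]; exact h.isBigO_deriv2.comp_tendsto ht

theorem exists_bound_of_isCompact {K : Set ℝ} (hK : IsCompact K)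
    (h : ∀ x ∈ K, IsRegularAlong A u x) :
    ∃ M : ℝ, 0 ≤ M ∧ ∀ y ∈ K ∩ A, |u y| ≤ M ∧ |deriv u y| ≤ M ∧ |deriv (deriv u) y| ≤ M := by
  refine hK.induction_on (p := fun s => ∃ M : ℝ, 0 ≤ M ∧ ∀ y ∈ s ∩ A,
    |u y| ≤ M ∧ |deriv u y| ≤ M ∧ |deriv (deriv u) y| ≤ M) ⟨0, le_rfl, by simp⟩ ?_ ?_ ?_
  · rintro s t hst ⟨M, hM, H⟩
    exact ⟨M, hM, fun y hy => H y ⟨hst hy.1, hy.2⟩⟩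
  · rintro s t ⟨M, hM, H⟩ ⟨N, hN, H'⟩
    refine ⟨max M N, le_max_of_le_left hM, fun y hy => ?_⟩
    rcases hy.1 with hs | ht
    · obtain ⟨h1, h2, h3⟩ := H y ⟨hs, hy.2⟩
      exact ⟨le_max_of_le_left h1, le_max_of_le_left h2, le_max_of_le_left h3⟩
    · obtain ⟨h1, h2, h3⟩ := H' y ⟨ht, hy.2⟩
      exact ⟨le_max_of_le_right h1, le_max_of_le_right h2, le_max_of_le_right h3⟩
  · intro x hx
    obtain ⟨a, ha⟩ := (h x hx).exists_tendsto
    obtain ⟨b, hb⟩ := (h x hx).exists_tendsto_deriv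
    obtain ⟨c₀, h0⟩ := (ha.isBigO_one ℝ).bound
    obtain ⟨c₁, h1⟩ := (hb.isBigO_one ℝ).bound
    obtain ⟨c₂, h2⟩ := (h x hx).isBigO_deriv2.bound
    have hev := h0.and (h1.and h2)
    rw [eventually_nhdsWithin_iff] at hev
    refine ⟨_, mem_nhdsWithin_of_mem_nhds hev, max 0 (max c₀ (max c₁ c₂)), le_max_left _ _, ?_⟩
    rintro y ⟨hy, hyA⟩
    obtain ⟨g0, g1, g2⟩ := hy hyA
    simp only [Real.norm_eq_abs, abs_one, mul_one] at g0 g1 g2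
    simp only [le_max_iff]
    tauto

theorem differentiableAt_of_mem (hA : IsOpen A) (h : IsRegularAlong A u x) (hx : x ∈ A) :
    DifferentiableAt ℝ u x := by
  have h1 := h.differentiableAt
  rw [hA.nhdsWithin_eq hx] at h1
  exact h1.self_of_nhds

theorem differentiableAt_deriv_of_mem (hA : IsOpen A) (h : IsRegularAlong A u x) (hx : x ∈ A) :
    DifferentiableAt ℝ (deriv u) x := by
  have h1 := h.differentiableAt_deriv
  rw [hA.nhdsWithin_eq hx] at h1
  exact h1.self_of_nhds

end IsRegularAlong

theorem integrable_of_abs_le_div_one_add_sq {v : ℝ → ℝ} {A : Set ℝ}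
    (hc : Aᶜ.Countable) {K : ℝ} (hm : AEStronglyMeasurable v volume)
    (hv : ∀ y ∈ A, |v y| ≤ K / (1 + y ^ 2)) : Integrable v := by
  refine (integrable_inv_one_add_sq.const_mul K).mono' hm ?_
  have : ∀ᵐ y : ℝ, y ∈ A := by
    have := hc.ae_notMem (volume : Measure ℝ)
    simpa using this
  filter_upwards [this] with y hy
  simpa [div_eq_mul_inv] using hv y hy

theorem integrable_of_isRegularAlong {u : ℝ → ℝ} {A : Set ℝ} (hA : IsOpen A)
    (hc : Aᶜ.Countable) {K : ℝ} (hreg : ∀ x, IsRegularAlong A u x)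
    (hv : ∀ y ∈ A, |u y| ≤ K / (1 + y ^ 2)) : Integrable u := by
  refine integrable_of_abs_le_div_one_add_sq hc ?_ hv
  have hcont : ContinuousOn u A := fun y hy =>
    ((hreg y).differentiableAt_of_mem hA hy).continuousAt.continuousWithinAt
  have h := hcont.aestronglyMeasurable (μ := volume) hA.measurableSet
  have hr : (volume : Measure ℝ).restrict A = volume := by
    refine Measure.restrict_eq_self_of_ae_mem ?_
    simpa using hc.ae_notMem (volume : Measure ℝ)
  rwa [hr] at h

/-- Integrating by parts twice costs no boundary terms at the exceptional points, because `u` and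
`u'` extend continuously across them; hence the Fourier integral of `u` is `O((1 + x²)⁻¹)`. -/
theorem exists_norm_fourierIntegral_le {u : ℝ → ℝ} {A : Set ℝ} (hA : IsOpen A)
    (hc : Aᶜ.Countable) {K : ℝ} (hreg : ∀ x, IsRegularAlong A u x)
    (h0 : ∀ y ∈ A, |u y| ≤ K / (1 + y ^ 2)) (h1 : ∀ y ∈ A, |deriv u y| ≤ K / (1 + y ^ 2))
    (h2 : ∀ y ∈ A, |deriv (deriv u) y| ≤ K / (1 + y ^ 2)) :
    ∃ C : ℝ, 0 ≤ C ∧ ∀ x : ℝ,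
      ‖∫ ξ : ℝ, (u ξ : ℂ) * Complex.exp (Complex.I * (x : ℂ) * (ξ : ℂ))‖ ≤ C / (1 + x ^ 2) := by
  have hA_dense : Dense A := by simpa using hc.dense_compl ℝ
  have iu : Integrable u := integrable_of_isRegularAlong hA hc hreg h0
  have iE : Integrable (deriv (deriv u)) := integrable_of_abs_le_div_one_add_sq hc
    (measurable_deriv _).aestronglyMeasurable h2
  have hnorm : ∀ x ξ : ℝ, ‖Complex.exp (Complex.I * (x : ℂ) * (ξ : ℂ))‖ = 1 := fun x ξ => by
    rw [show Complex.I * (x : ℂ) * (ξ : ℂ) = ((x * ξ : ℝ) : ℂ) * Complex.I by push_cast; ring,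
      Complex.norm_exp_ofReal_mul_I]
  have hint : ∀ {v : ℝ → ℝ}, Integrable v → ∀ x : ℝ,
      Integrable fun ξ : ℝ => (v ξ : ℂ) * Complex.exp (Complex.I * (x : ℂ) * (ξ : ℂ)) := by
    intro v hv x
    refine hv.ofReal.mul_bdd (c := 1) (by fun_prop) (Eventually.of_forall fun ξ => ?_)
    exact (hnorm x ξ).le
  have hle : ∀ {v : ℝ → ℝ} (x : ℝ),
      ‖∫ ξ : ℝ, (v ξ : ℂ) * Complex.exp (Complex.I * (x : ℂ) * (ξ : ℂ))‖ ≤ ∫ ξ : ℝ, |v ξ| := by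
    intro v x
    refine (norm_integral_le_integral_norm _).trans_eq (integral_congr_ae ?_)
    refine Eventually.of_forall fun ξ => ?_
    simp [hnorm]
  refine ⟨(∫ ξ : ℝ, |u ξ|) + ∫ ξ : ℝ, |deriv (deriv u) ξ|, by positivity, fun x => ?_⟩
  rw [le_div_iff₀ (by positivity), mul_add, mul_one]
  refine add_le_add (hle x) ?_
  rcases eq_or_ne x 0 with rfl | hx
  · simpa using integral_nonneg fun ξ => abs_nonneg (deriv (deriv u) ξ)
  set e : ℝ → ℂ := fun ξ => Complex.exp (Complex.I * (x : ℂ) * (ξ : ℂ)) with he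
  have hec : Continuous e := by fun_prop
  have hed : ∀ ξ : ℝ, HasDerivAt e (Complex.I * x * e ξ) ξ := by
    intro ξ
    have : HasDerivAt (fun ξ : ℝ => Complex.I * (x : ℂ) * (ξ : ℂ)) (Complex.I * x) ξ := by
      simpa using (Complex.ofRealCLM.hasDerivAt (x := ξ)).const_mul (Complex.I * (x : ℂ))
    simpa [he, mul_comm] using this.cexp
  have hxC : (x : ℂ) ≠ 0 := by exact_mod_cast hx
  -- In the derivative `F' = -x² u e - u'' e` the terms with `u'` cancel.
  set F : ℝ → ℂ := fun ξ => (Complex.I * x * (u ξ : ℂ) - ((deriv u ξ : ℝ) : ℂ)) * e ξ with hF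
  set F' : ℝ → ℂ := fun ξ => -(x : ℂ) ^ 2 * ((u ξ : ℂ) * e ξ) - ((deriv (deriv u) ξ : ℝ) : ℂ) * e ξ
    with hF'
  have hFd : ∀ ξ ∈ A, HasDerivAt F (F' ξ) ξ := by
    intro ξ hξ
    have d0 := ((hreg ξ).differentiableAt_of_mem hA hξ).hasDerivAt.ofReal_comp
    have d1 := ((hreg ξ).differentiableAt_deriv_of_mem hA hξ).hasDerivAt.ofReal_comp
    convert! ((d0.const_mul (Complex.I * (x : ℂ))).sub d1).mul (hed ξ) using 1
    simp only [hF', Pi.sub_apply]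
    linear_combination (-(x : ℂ) ^ 2 * u ξ * e ξ) * Complex.I_sq
  have hFlim : ∀ ξ, ∃ z, Tendsto F (𝓝[A] ξ) (𝓝 z) := by
    intro ξ
    obtain ⟨a, ha⟩ := (hreg ξ).exists_tendsto
    obtain ⟨b, hb⟩ := (hreg ξ).exists_tendsto_deriv
    have ha' := (Complex.continuous_ofReal.tendsto a).comp ha
    have hb' := (Complex.continuous_ofReal.tendsto b).comp hb
    exact ⟨_, ((ha'.const_mul (Complex.I * x)).sub hb').mul
      ((hec.tendsto ξ).mono_left nhdsWithin_le_nhds)⟩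
  set G := extendFrom A F with hG
  have hGc : Continuous G := continuous_extendFrom hA_dense hFlim
  have hGF : EqOn G F A := extendFrom_extends fun ξ hξ =>
    (hFd ξ hξ).continuousAt.continuousWithinAt
  have hGd : ∀ ξ ∈ A, HasDerivAt G (F' ξ) ξ := fun ξ hξ =>
    (hFd ξ hξ).congr_of_eventuallyEq (hGF.eventuallyEq_of_mem (hA.mem_nhds hξ))
  have hGb : ∀ ξ, ‖G ξ‖ ≤ (|x| + 1) * K / (1 + ξ ^ 2) := by
    have hcl : IsClosed {ξ : ℝ | ‖G ξ‖ ≤ (|x| + 1) * K / (1 + ξ ^ 2)} :=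
      isClosed_le (by fun_prop) (by
        refine Continuous.div (by fun_prop) (by fun_prop) fun ξ => by positivity)
    have hsub : A ⊆ {ξ : ℝ | ‖G ξ‖ ≤ (|x| + 1) * K / (1 + ξ ^ 2)} := by
      intro ξ hξ
      have e0 := h0 ξ hξ
      have e1 := h1 ξ hξ
      simp only [mem_ofPred_eq, hGF hξ, hF, norm_mul, he, hnorm, mul_one]
      calc _ ≤ ‖Complex.I * x * (u ξ : ℂ)‖ + ‖((deriv u ξ : ℝ) : ℂ)‖ := norm_sub_le _ _
        _ = |x| * |u ξ| + |deriv u ξ| := by simp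
        _ ≤ |x| * (K / (1 + ξ ^ 2)) + K / (1 + ξ ^ 2) := by gcongr
        _ = _ := by ring
    intro ξ
    exact hcl.closure_subset_iff.2 hsub (hA_dense ξ)
  have hlim : Tendsto (fun ξ : ℝ => (|x| + 1) * K / (1 + ξ ^ 2)) (cocompact ℝ) (𝓝 0) := by
    refine Tendsto.div_atTop tendsto_const_nhds ?_
    refine tendsto_atTop_add_const_left _ _ ?_
    have := (tendsto_pow_atTop (α := ℝ) two_ne_zero).comp (tendsto_norm_cocompact_atTop (E := ℝ))
    refine this.congr fun ξ => by simp
  have hG0 : Tendsto G (cocompact ℝ) (𝓝 0) := squeeze_zero_norm hGb hlim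
  have iF' : Integrable F' := ((hint iu x).const_mul _).sub (hint iE x)
  have hFTC : ∀ R : ℝ, ∫ ξ in (-R)..R, F' ξ = G R - G (-R) := fun R =>
    integral_eq_of_hasDerivAt_off_countable G F' hc hGc.continuousOn
      (fun ξ hξ => hGd ξ (by simpa using hξ.2)) iF'.intervalIntegrable
  have hz : ∫ ξ, F' ξ = 0 := by
    have t1 := intervalIntegral_tendsto_integral iF' tendsto_neg_atTop_atBot tendsto_id
    have t2 : Tendsto (fun R : ℝ => G R - G (-R)) atTop (𝓝 (0 - 0)) :=
      (hG0.mono_left atTop_le_cocompact).sub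
        ((hG0.mono_left atBot_le_cocompact).comp tendsto_neg_atTop_atBot)
    rw [sub_zero] at t2
    exact tendsto_nhds_unique (t1.congr fun R => hFTC R) t2
  rw [hF', integral_sub ((hint iu x).const_mul _) (hint iE x), integral_const_mul] at hz
  have hz' : (x : ℂ) ^ 2 * ∫ ξ, (u ξ : ℂ) * e ξ = -∫ ξ, ((deriv (deriv u) ξ : ℝ) : ℂ) * e ξ := by
    linear_combination -hz
  calc ‖∫ ξ, (u ξ : ℂ) * e ξ‖ * x ^ 2 = ‖(x : ℂ) ^ 2 * ∫ ξ, (u ξ : ℂ) * e ξ‖ := by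
        rw [norm_mul, norm_pow, Complex.norm_real, Real.norm_eq_abs, sq_abs, mul_comm]
    _ ≤ _ := by rw [hz', norm_neg]; exact hle x

/-! ### Periodization of a symbol -/

/-- The complement of `2πℤ`. -/
def nonPeriods : Set ℝ := {ξ | Real.sin (ξ / 2) ≠ 0}

theorem isOpen_nonPeriods : IsOpen nonPeriods :=
  isOpen_ne_fun (by fun_prop) (by fun_prop)

theorem countable_compl_nonPeriods : (nonPeriodsᶜ).Countable := by
  refine (countable_range fun n : ℤ => 2 * (n * Real.pi)).mono fun ξ hξ => ?_
  have h : Real.sin (ξ / 2) = 0 := by simpa [nonPeriods] using hξ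
  obtain ⟨n, hn⟩ := Real.sin_eq_zero_iff.1 h
  exact ⟨n, by simp only [hn]; ring⟩

theorem nonPeriods_subset : nonPeriods ⊆ {0}ᶜ := by
  rintro ξ hξ rfl
  simp [nonPeriods] at hξ

theorem add_mem_nonPeriods {ξ : ℝ} (hξ : ξ ∈ nonPeriods) (m : ℤ) :
    ξ + 2 * Real.pi * m ∈ nonPeriods := by
  have h : Real.sin (ξ / 2) ≠ 0 := hξ
  change Real.sin ((ξ + 2 * Real.pi * m) / 2) ≠ 0
  rw [show (ξ + 2 * Real.pi * m) / 2 = ξ / 2 + m * Real.pi by ring, Real.sin_add_int_mul_pi]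
  exact mul_ne_zero (zpow_ne_zero _ (by norm_num)) h

theorem exists_abs_add_period_le (ξ : ℝ) : ∃ m : ℤ, |ξ + 2 * Real.pi * m| ≤ Real.pi := by
  refine ⟨-round (ξ / (2 * Real.pi)), ?_⟩
  have h := abs_sub_round (ξ / (2 * Real.pi))
  have hp := Real.pi_pos
  have : ξ + 2 * Real.pi * ((-round (ξ / (2 * Real.pi)) : ℤ) : ℝ) =
      2 * Real.pi * (ξ / (2 * Real.pi) - round (ξ / (2 * Real.pi))) := by
    push_cast; field_simp; ring
  rw [this, abs_mul, abs_of_pos (by positivity)]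
  calc _ ≤ 2 * Real.pi * (1 / 2) := by gcongr
    _ = _ := by ring

/-- The conditions on a symbol `f` under which `f / ∑_j f(· + 2πj)` has an integrable second
derivative: `f` is positive and `C²` off the origin, decays quadratically with its first two
derivatives, and its reciprocal is regular at the origin. The symbol itself may blow up there. -/
structure IsCardinalSymbol (f : ℝ → ℝ) : Prop where
  pos : ∀ ξ, ξ ≠ 0 → 0 < f ξ
  contDiffOn : ContDiffOn ℝ 2 f {0}ᶜ
  exists_decay : ∃ C : ℝ, ∀ ξ, 1 ≤ |ξ| →
    |f ξ| ≤ C / ξ ^ 2 ∧ |deriv f ξ| ≤ C / ξ ^ 2 ∧ |deriv (deriv f) ξ| ≤ C / ξ ^ 2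
  isRegularAlong_inv : IsRegularAlong {0}ᶜ (fun ξ => (f ξ)⁻¹) 0

/-- The periodization `∑_j f(ξ + 2πj)`. -/
noncomputable def periodization (f : ℝ → ℝ) (ξ : ℝ) : ℝ := ∑' j : ℤ, f (ξ + 2 * Real.pi * j)

/-- The periodization without its term `j = 0`. -/
noncomputable def puncturedPeriodization (f : ℝ → ℝ) (ξ : ℝ) : ℝ :=
  ∑' j : ℤ, if j = 0 then 0 else f (ξ + 2 * Real.pi * j)

theorem periodization_add (f : ℝ → ℝ) (ξ : ℝ) (m : ℤ) :
    periodization f (ξ + 2 * Real.pi * m) = periodization f ξ := by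
  unfold periodization
  rw [← (Equiv.addLeft m).tsum_eq fun j : ℤ => f (ξ + 2 * Real.pi * j)]
  refine tsum_congr fun j => ?_
  simp only [Equiv.coe_addLeft]
  congr 1
  push_cast; ring

theorem abs_le_abs_add_period {ξ : ℝ} (hξ : ξ ∈ Ioo (-4 : ℝ) 4) {j : ℤ} (hj : j ≠ 0) :
    |(j : ℝ)| ≤ |ξ + 2 * Real.pi * j| ∧ 1 ≤ |(j : ℝ)| := by
  have h1 : 1 ≤ |(j : ℝ)| := by
    have := Int.one_le_abs hj
    exact_mod_cast this
  refine ⟨?_, h1⟩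
  have h2 : |ξ| < 4 := abs_lt.2 hξ
  have h3 : |2 * Real.pi * (j : ℝ)| ≤ |ξ + 2 * Real.pi * j| + |ξ| := by
    have := abs_sub (ξ + 2 * Real.pi * j) ξ
    simpa using this
  rw [abs_mul, abs_of_pos (by positivity)] at h3
  nlinarith [Real.pi_gt_three]

namespace IsCardinalSymbol

variable {f : ℝ → ℝ} (hf : IsCardinalSymbol f)

include hf

theorem differentiableAt {ξ : ℝ} (hξ : ξ ≠ 0) : DifferentiableAt ℝ f ξ :=
  (IsRegularAlong.of_contDiffOn isOpen_compl_singleton isOpen_compl_singleton hf.contDiffOn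
    hξ).differentiableAt_of_mem isOpen_compl_singleton hξ

theorem differentiableAt_deriv {ξ : ℝ} (hξ : ξ ≠ 0) : DifferentiableAt ℝ (deriv f) ξ :=
  (IsRegularAlong.of_contDiffOn isOpen_compl_singleton isOpen_compl_singleton hf.contDiffOn
    hξ).differentiableAt_deriv_of_mem isOpen_compl_singleton hξ

theorem isRegularAlong {ξ : ℝ} (hξ : ξ ≠ 0) : IsRegularAlong nonPeriods f ξ :=
  IsRegularAlong.of_contDiffOn isOpen_nonPeriods isOpen_compl_singleton hf.contDiffOn hξ

theorem exists_bound_add_period : ∃ C : ℝ, 0 ≤ C ∧ ∀ ξ ∈ Ioo (-4 : ℝ) 4, ∀ j : ℤ,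
    ‖if j = 0 then 0 else f (ξ + 2 * Real.pi * j)‖ ≤ C * (1 / (j : ℝ) ^ 2) ∧
    ‖if j = 0 then 0 else deriv f (ξ + 2 * Real.pi * j)‖ ≤ C * (1 / (j : ℝ) ^ 2) ∧
    ‖if j = 0 then 0 else deriv (deriv f) (ξ + 2 * Real.pi * j)‖ ≤ C * (1 / (j : ℝ) ^ 2) := by
  obtain ⟨C, hC⟩ := hf.exists_decay
  have hC0 : 0 ≤ C := by
    have := (hC 1 (by simp)).1
    simp only [one_pow, div_one] at this
    exact (abs_nonneg _).trans this
  refine ⟨C, hC0, fun ξ hξ j => ?_⟩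
  rcases eq_or_ne j 0 with rfl | hj
  · simp
  · obtain ⟨h1, h2⟩ := abs_le_abs_add_period hξ hj
    obtain ⟨g0, g1, g2⟩ := hC _ (h2.trans h1)
    have hle : C / (ξ + 2 * Real.pi * j) ^ 2 ≤ C * (1 / (j : ℝ) ^ 2) := by
      rw [mul_one_div]
      have : 0 < (j : ℝ) ^ 2 := by positivity
      gcongr C / ?_
      exact sq_le_sq.2 h1
    simp only [hj, if_false, Real.norm_eq_abs]
    exact ⟨g0.trans hle, g1.trans hle, g2.trans hle⟩

theorem summable_punctured {ξ : ℝ} (hξ : ξ ∈ Ioo (-4 : ℝ) 4) :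
    Summable fun j : ℤ => if j = 0 then 0 else f (ξ + 2 * Real.pi * j) := by
  obtain ⟨C, -, hC⟩ := hf.exists_bound_add_period
  exact Summable.of_norm_bounded ((Real.summable_one_div_int_pow.2 one_lt_two).mul_left C)
    fun j => (hC ξ hξ j).1

theorem periodization_eq {ξ : ℝ} (hξ : ξ ∈ Ioo (-4 : ℝ) 4) :
    periodization f ξ = f ξ + puncturedPeriodization f ξ := by
  have hs := hf.summable_punctured hξ
  have hs' : Summable fun j : ℤ => f (ξ + 2 * Real.pi * j) := by
    refine hs.congr_cofinite ?_
    filter_upwards [(finite_singleton (0 : ℤ)).eventually_cofinite_notMem] with j hj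
    have : j ≠ 0 := by simpa using hj
    simp [this]
  rw [periodization, hs'.tsum_eq_add_tsum_ite 0]
  simp [puncturedPeriodization]

theorem puncturedPeriodization_nonneg {ξ : ℝ} (hξ : ξ ∈ Ioo (-4 : ℝ) 4) :
    0 ≤ puncturedPeriodization f ξ := by
  refine tsum_nonneg fun j => ?_
  split_ifs with hj
  · exact le_rfl
  · obtain ⟨h1, h2⟩ := abs_le_abs_add_period hξ hj
    exact (hf.pos _ (abs_pos.1 (by linarith))).le

theorem isRegularAlong_puncturedPeriodization {ξ : ℝ} (hξ : ξ ∈ Ioo (-4 : ℝ) 4) :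
    IsRegularAlong nonPeriods (puncturedPeriodization f) ξ := by
  obtain ⟨C, hC0, hC⟩ := hf.exists_bound_add_period
  have hsum : Summable fun j : ℤ => C * (1 / (j : ℝ) ^ 2) :=
    (Real.summable_one_div_int_pow.2 one_lt_two).mul_left C
  have hne : ∀ y ∈ Ioo (-4 : ℝ) 4, ∀ j : ℤ, j ≠ 0 → y + 2 * Real.pi * j ≠ 0 := by
    intro y hy j hj
    obtain ⟨h1, h2⟩ := abs_le_abs_add_period hy hj
    exact abs_pos.1 (by linarith)
  have d0 : ∀ y ∈ Ioo (-4 : ℝ) 4, HasDerivAt (puncturedPeriodization f)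
      (∑' j : ℤ, if j = 0 then 0 else deriv f (y + 2 * Real.pi * j)) y := by
    intro y hy
    refine hasDerivAt_tsum_of_isPreconnected hsum isOpen_Ioo isPreconnected_Ioo
      (g := fun (j : ℤ) y => if j = 0 then 0 else f (y + 2 * Real.pi * j))
      (g' := fun (j : ℤ) y => if j = 0 then 0 else deriv f (y + 2 * Real.pi * j))
      (fun j z hz => ?_) (fun j z hz => (hC z hz j).2.1) hy (hf.summable_punctured hy) hy
    split_ifs with hj
    · exact hasDerivAt_const _ _
    · exact (hf.differentiableAt (hne z hz j hj)).hasDerivAt.comp_add_const z _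
  have d1 : ∀ y ∈ Ioo (-4 : ℝ) 4,
      HasDerivAt (fun y => ∑' j : ℤ, if j = 0 then 0 else deriv f (y + 2 * Real.pi * j))
      (∑' j : ℤ, if j = 0 then 0 else deriv (deriv f) (y + 2 * Real.pi * j)) y := by
    intro y hy
    refine hasDerivAt_tsum_of_isPreconnected hsum isOpen_Ioo isPreconnected_Ioo
      (g := fun (j : ℤ) y => if j = 0 then 0 else deriv f (y + 2 * Real.pi * j))
      (g' := fun (j : ℤ) y => if j = 0 then 0 else deriv (deriv f) (y + 2 * Real.pi * j))
      (fun j z hz => ?_) (fun j z hz => (hC z hz j).2.2) hy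
      (Summable.of_norm_bounded hsum fun j => (hC y hy j).2.1) hy
    split_ifs with hj
    · exact hasDerivAt_const _ _
    · exact (hf.differentiableAt_deriv (hne z hz j hj)).hasDerivAt.comp_add_const z _
  have hev : ∀ᶠ y in 𝓝[nonPeriods] ξ, y ∈ Ioo (-4 : ℝ) 4 :=
    nhdsWithin_le_nhds (isOpen_Ioo.mem_nhds hξ)
  refine IsRegularAlong.of_hasDerivAt isOpen_nonPeriods (hev.mono d0) (hev.mono d1)
    ((d0 ξ hξ).continuousAt.tendsto.mono_left nhdsWithin_le_nhds)
    ((d1 ξ hξ).continuousAt.tendsto.mono_left nhdsWithin_le_nhds) ?_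
  refine Asymptotics.IsBigO.of_bound (∑' j : ℤ, C * (1 / (j : ℝ) ^ 2)) ?_
  filter_upwards [hev] with y hy
  rw [norm_one, mul_one]
  exact tsum_of_norm_bounded hsum.hasSum fun j => (hC y hy j).2.2

/-- Near the origin, `(∑_j f(ξ + 2πj))⁻¹ = f⁻¹ (1 + f⁻¹ S)⁻¹`, where `S` is the punctured
periodization; the second factor is `f / ∑_j f(· + 2πj)`. -/
theorem isRegularAlong_one_add_inv {ξ : ℝ} (hξ : ξ ∈ Ioo (-4 : ℝ) 4) :
    IsRegularAlong nonPeriods (fun y => (f y)⁻¹) ξ ∧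
    IsRegularAlong nonPeriods (fun y => (1 + (f y)⁻¹ * puncturedPeriodization f y)⁻¹) ξ := by
  have h1 : IsRegularAlong nonPeriods (fun y => (f y)⁻¹) ξ := by
    rcases eq_or_ne ξ 0 with rfl | h0
    · exact hf.isRegularAlong_inv.mono nonPeriods_subset
    · exact (hf.isRegularAlong h0).inv isOpen_nonPeriods
        ((hf.differentiableAt h0).continuousAt.tendsto.mono_left nhdsWithin_le_nhds)
        (hf.pos ξ h0).ne'
  refine ⟨h1, ?_⟩
  have h2 := (h1.mul isOpen_nonPeriods
    (hf.isRegularAlong_puncturedPeriodization hξ)).const_add isOpen_nonPeriods 1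
  obtain ⟨a, ha⟩ := h2.exists_tendsto
  refine h2.inv isOpen_nonPeriods ha ?_
  have hdense : Dense nonPeriods := by simpa using countable_compl_nonPeriods.dense_compl ℝ
  have : (𝓝[nonPeriods] ξ).NeBot := mem_closure_iff_nhdsWithin_neBot.1 (hdense ξ)
  have : 1 ≤ a := by
    refine ge_of_tendsto ha ?_
    filter_upwards [self_mem_nhdsWithin,
      nhdsWithin_le_nhds (isOpen_Ioo.mem_nhds hξ)] with y hy hyU
    have := hf.pos y (nonPeriods_subset hy)
    have := hf.puncturedPeriodization_nonneg hyU
    have : 0 ≤ (f y)⁻¹ * puncturedPeriodization f y := by positivity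
    linarith
  linarith

theorem isRegularAlong_inv_periodization (ξ : ℝ) :
    IsRegularAlong nonPeriods (fun y => (periodization f y)⁻¹) ξ := by
  obtain ⟨m, hm⟩ := exists_abs_add_period_le ξ
  have hU : ξ + 2 * Real.pi * m ∈ Ioo (-4 : ℝ) 4 := by
    rw [mem_Ioo, ← abs_lt]
    linarith [Real.pi_lt_four]
  obtain ⟨h1, h2⟩ := hf.isRegularAlong_one_add_inv hU
  have h3 : IsRegularAlong nonPeriods (fun y => (periodization f y)⁻¹) (ξ + 2 * Real.pi * m) := by
    refine (h1.mul isOpen_nonPeriods h2).congr isOpen_nonPeriods ?_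
    filter_upwards [self_mem_nhdsWithin,
      nhdsWithin_le_nhds (isOpen_Ioo.mem_nhds hU)] with y hy hyU
    have := hf.pos y (nonPeriods_subset hy)
    rw [hf.periodization_eq hyU, ← mul_inv]
    congr 1
    field_simp
  have h4 := h3.comp_add_const fun y hy => add_mem_nonPeriods hy m
  simpa only [periodization_add] using h4

theorem isRegularAlong_div_periodization (ξ : ℝ) :
    IsRegularAlong nonPeriods (fun y => f y / periodization f y) ξ := by
  rcases eq_or_ne ξ 0 with rfl | h0
  · have hU : (0 : ℝ) ∈ Ioo (-4 : ℝ) 4 := by norm_num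
    refine (hf.isRegularAlong_one_add_inv hU).2.congr isOpen_nonPeriods ?_
    filter_upwards [self_mem_nhdsWithin,
      nhdsWithin_le_nhds (isOpen_Ioo.mem_nhds hU)] with y hy hyU
    have := hf.pos y (nonPeriods_subset hy)
    have := hf.puncturedPeriodization_nonneg hyU
    rw [hf.periodization_eq hyU]
    field_simp
  · simpa only [div_eq_mul_inv] using
      (hf.isRegularAlong h0).mul isOpen_nonPeriods (hf.isRegularAlong_inv_periodization ξ)

theorem exists_bound_inv_periodization : ∃ M : ℝ, 0 ≤ M ∧ ∀ ξ ∈ nonPeriods,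
    |(periodization f ξ)⁻¹| ≤ M ∧ |deriv (fun y => (periodization f y)⁻¹) ξ| ≤ M ∧
      |deriv (deriv fun y => (periodization f y)⁻¹) ξ| ≤ M := by
  obtain ⟨M, hM, H⟩ := IsRegularAlong.exists_bound_of_isCompact
    (isCompact_Icc (a := -Real.pi) (b := Real.pi))
    fun ξ _ => hf.isRegularAlong_inv_periodization ξ
  refine ⟨M, hM, fun ξ hξ => ?_⟩
  obtain ⟨m, hm⟩ := exists_abs_add_period_le ξ
  have key := H (ξ + 2 * Real.pi * m) ⟨abs_le.1 hm, add_mem_nonPeriods hξ m⟩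
  set P : ℝ → ℝ := fun y => (periodization f y)⁻¹ with hP
  have e0 : ∀ y, P (y + 2 * Real.pi * m) = P y := fun y => by
    simp only [hP, periodization_add]
  have e1 : ∀ y, deriv P (y + 2 * Real.pi * m) = deriv P y := fun y => by
    rw [← deriv_comp_add_const]; simp only [e0]
  have e2 : deriv (deriv P) (ξ + 2 * Real.pi * m) = deriv (deriv P) ξ := by
    rw [← deriv_comp_add_const]; simp only [e1]
  rw [e1, e2, periodization_add] at key
  exact key

theorem exists_bound_div_periodization : ∃ K : ℝ, ∀ ξ ∈ nonPeriods,
    |f ξ / periodization f ξ| ≤ K / (1 + ξ ^ 2) ∧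
    |deriv (fun y => f y / periodization f y) ξ| ≤ K / (1 + ξ ^ 2) ∧
      |deriv (deriv fun y => f y / periodization f y) ξ| ≤ K / (1 + ξ ^ 2) := by
  obtain ⟨M, hM, H⟩ := hf.exists_bound_inv_periodization
  obtain ⟨N, hN, H'⟩ := IsRegularAlong.exists_bound_of_isCompact
    (isCompact_Icc (a := (-1 : ℝ)) (b := 1)) fun ξ _ => hf.isRegularAlong_div_periodization ξ
  obtain ⟨C, hC⟩ := hf.exists_decay
  have hC0 : 0 ≤ C := by
    have := (hC 1 (by simp)).1
    simp only [one_pow, div_one] at this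
    exact (abs_nonneg _).trans this
  refine ⟨2 * N + 8 * (C * M), fun ξ hξ => ?_⟩
  rcases le_total |ξ| 1 with h | h
  · have h1 : N ≤ (2 * N + 8 * (C * M)) / (1 + ξ ^ 2) := by
      rw [le_div_iff₀ (by positivity)]
      have : ξ ^ 2 ≤ 1 := (sq_le_one_iff_abs_le_one ξ).2 h
      nlinarith [mul_nonneg hC0 hM]
    obtain ⟨g0, g1, g2⟩ := H' ξ ⟨abs_le.1 h, hξ⟩
    exact ⟨g0.trans h1, g1.trans h1, g2.trans h1⟩
  · obtain ⟨p0, p1, p2⟩ := H ξ hξ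
    obtain ⟨f0, f1, f2⟩ := hC ξ h
    set P : ℝ → ℝ := fun y => (periodization f y)⁻¹ with hP
    have hu : (fun y => f y / periodization f y) = fun y => f y * P y := by
      funext y; rw [div_eq_mul_inv]
    have hreg := hf.isRegularAlong_inv_periodization ξ
    have hξ0 : ξ ≠ 0 := nonPeriods_subset hξ
    have hev : ∀ᶠ y in 𝓝 ξ, y ∈ nonPeriods := isOpen_nonPeriods.mem_nhds hξ
    have d0 : ∀ y ∈ nonPeriods, HasDerivAt (fun y => f y * P y)
        (deriv f y * P y + f y * deriv P y) y := fun y hy =>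
      (hf.differentiableAt (nonPeriods_subset hy)).hasDerivAt.mul
        ((hf.isRegularAlong_inv_periodization y).differentiableAt_of_mem
          isOpen_nonPeriods hy).hasDerivAt
    have e1 : deriv (fun y => f y * P y) =ᶠ[𝓝 ξ] fun y => deriv f y * P y + f y * deriv P y :=
      hev.mono fun y hy => (d0 y hy).deriv
    have dP := (hreg.differentiableAt_of_mem isOpen_nonPeriods hξ).hasDerivAt
    have dP1 := (hreg.differentiableAt_deriv_of_mem isOpen_nonPeriods hξ).hasDerivAt
    have e2 : deriv (deriv fun y => f y * P y) ξ =
        (deriv (deriv f) ξ * P ξ + deriv f ξ * deriv P ξ) +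
          (deriv f ξ * deriv P ξ + f ξ * deriv (deriv P) ξ) := by
      rw [e1.deriv_eq]
      exact (((hf.differentiableAt_deriv hξ0).hasDerivAt.mul dP).add
        ((hf.differentiableAt hξ0).hasDerivAt.mul dP1)).deriv
    have hD0 : 0 ≤ C / ξ ^ 2 := by positivity
    have hmul : ∀ {s t : ℝ}, |s| ≤ C / ξ ^ 2 → |t| ≤ M → |s * t| ≤ C / ξ ^ 2 * M :=
      fun hs ht => by rw [abs_mul]; gcongr
    have hfin : 4 * (C / ξ ^ 2 * M) ≤ (2 * N + 8 * (C * M)) / (1 + ξ ^ 2) := by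
      have h1 : 1 ≤ ξ ^ 2 := (one_le_sq_iff_one_le_abs ξ).2 h
      have h2 : 0 < ξ ^ 2 := by linarith
      have h3 : 0 ≤ C * M := mul_nonneg hC0 hM
      rw [le_div_iff₀ (by positivity),
        show 4 * (C / ξ ^ 2 * M) * (1 + ξ ^ 2) = 4 * (C * M) * ((1 + ξ ^ 2) / ξ ^ 2) by ring]
      have h4 : (1 + ξ ^ 2) / ξ ^ 2 ≤ 2 := by rw [div_le_iff₀ h2]; linarith
      nlinarith
    have hB : 0 ≤ C / ξ ^ 2 * M := by positivity
    rw [hu, e2, (d0 ξ hξ).deriv, div_eq_mul_inv]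
    have a0 := hmul f0 p0
    have a1 := hmul f1 p0
    have a2 := hmul f0 p1
    have a3 := hmul f2 p0
    have a4 := hmul f1 p1
    have a5 := hmul f0 p2
    refine ⟨by linarith, ?_, ?_⟩
    · exact (abs_add_le _ _).trans (by linarith)
    · refine (abs_add_le _ _).trans ?_
      have b1 := abs_add_le (deriv (deriv f) ξ * P ξ) (deriv f ξ * deriv P ξ)
      have b2 := abs_add_le (deriv f ξ * deriv P ξ) (f ξ * deriv (deriv P) ξ)
      linarith

theorem integrable_div_periodization : Integrable fun ξ => f ξ / periodization f ξ := by
  obtain ⟨K, hK⟩ := hf.exists_bound_div_periodization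
  exact integrable_of_isRegularAlong isOpen_nonPeriods countable_compl_nonPeriods
    hf.isRegularAlong_div_periodization fun y hy => (hK y hy).1

theorem exists_norm_fourierIntegral_div_periodization_le :
    ∃ C : ℝ, 0 ≤ C ∧ ∀ x : ℝ, ‖∫ ξ : ℝ, ((f ξ / periodization f ξ : ℝ) : ℂ) *
      Complex.exp (Complex.I * (x : ℂ) * (ξ : ℂ))‖ ≤ C / (1 + x ^ 2) := by
  obtain ⟨K, hK⟩ := hf.exists_bound_div_periodization
  exact exists_norm_fourierIntegral_le isOpen_nonPeriods countable_compl_nonPeriods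
    hf.isRegularAlong_div_periodization (fun y hy => (hK y hy).1) (fun y hy => (hK y hy).2.1)
    fun y hy => (hK y hy).2.2

end IsCardinalSymbol

/-! ### Boundedness of interpolation operators with a decaying kernel -/

theorem one_div_one_add_sq_le {x : ℝ} (hx0 : 0 ≤ x) (hx1 : x ≤ 1) (j : ℤ) :
    1 / (1 + (x - j) ^ 2) ≤ 3 * (1 / (j : ℝ) ^ 2 + if j = 0 then 1 else 0) := by
  rcases eq_or_ne j 0 with rfl | hj
  · have : 1 / (1 + (x - ((0 : ℤ) : ℝ)) ^ 2) ≤ 1 := by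
      rw [div_le_one (by positivity)]; nlinarith [sq_nonneg (x - ((0 : ℤ) : ℝ))]
    simp only [if_true, Int.cast_zero] at this ⊢
    norm_num
    simp only [sub_zero, one_div] at this
    linarith
  · have h : 0 < (j : ℝ) ^ 2 := by positivity
    simp only [hj, if_false, add_zero]
    rw [mul_one_div, div_le_div_iff₀ (by positivity) h]
    nlinarith [sq_nonneg (2 * x - j), mul_nonneg hx0 (sub_nonneg.2 hx1)]

section ShiftSeries

variable {L : ℝ → ℂ} {C : ℝ} (hC : 0 ≤ C) (hL : ∀ x, ‖L x‖ ≤ C / (1 + x ^ 2))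

include hC hL

theorem exists_summable_and_tsum_norm_shift_le : ∃ B : ℝ, ∀ x : ℝ,
    (Summable fun j : ℤ => ‖L (x - j)‖) ∧ ∑' j : ℤ, ‖L (x - j)‖ ≤ B := by
  have hs : Summable fun j : ℤ => C * (3 * (1 / (j : ℝ) ^ 2 + if j = 0 then (1 : ℝ) else 0)) :=
    (((Real.summable_one_div_int_pow.2 one_lt_two).add
      (hasSum_ite_eq 0 (1 : ℝ)).summable).mul_left 3).mul_left C
  refine ⟨∑' j : ℤ, C * (3 * (1 / (j : ℝ) ^ 2 + if j = 0 then (1 : ℝ) else 0)), fun x => ?_⟩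
  -- The series is `1`-periodic in `x`, so only `x ∈ [0, 1)` matters.
  have hb : ∀ j : ℤ, ‖L (x - ((j + ⌊x⌋ : ℤ) : ℝ))‖ ≤
      C * (3 * (1 / (j : ℝ) ^ 2 + if j = 0 then (1 : ℝ) else 0)) := by
    intro j
    have h1 := one_div_one_add_sq_le (Int.fract_nonneg x) (Int.fract_lt_one x).le j
    have h2 : x - ((j + ⌊x⌋ : ℤ) : ℝ) = Int.fract x - j := by
      push_cast; rw [← Int.self_sub_floor]; ring
    rw [h2]
    refine (hL _).trans ?_
    rw [← mul_one_div]
    gcongr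
  have hs' : Summable fun j : ℤ => ‖L (x - ((j + ⌊x⌋ : ℤ) : ℝ))‖ :=
    Summable.of_nonneg_of_le (fun _ => norm_nonneg _) hb hs
  have e := (Equiv.addRight ⌊x⌋).summable_iff (f := fun j : ℤ => ‖L (x - j)‖)
  have e' := (Equiv.addRight ⌊x⌋).tsum_eq fun j : ℤ => ‖L (x - j)‖
  refine ⟨e.1 hs', ?_⟩
  rw [← e']
  exact hs'.tsum_le_tsum hb hs

theorem summable_mul_shift {p : ℝ≥0∞} [Fact (1 ≤ p)] (y : lp (fun _ : ℤ => ℂ) p) (x : ℝ) :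
    Summable fun j : ℤ => y j * L (x - (j : ℝ)) := by
  obtain ⟨B, hB⟩ := exists_summable_and_tsum_norm_shift_le hC hL
  have hp0 : p ≠ 0 := (zero_lt_one.trans_le (Fact.out : 1 ≤ p)).ne'
  refine Summable.of_norm_bounded ((hB x).1.mul_left ‖y‖) fun j => ?_
  rw [norm_mul]
  gcongr
  exact lp.norm_apply_le_norm hp0 y j

theorem measurable_tsum_mul_shift (hLm : Measurable L) {p : ℝ≥0∞} [Fact (1 ≤ p)]
    (y : lp (fun _ : ℤ => ℂ) p) : Measurable fun x : ℝ => ∑' j : ℤ, y j * L (x - (j : ℝ)) := by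
  refine measurable_of_tendsto_metrizable' (atTop : Filter (Finset ℤ))
    (f := fun s x => ∑ j ∈ s, y j * L (x - (j : ℝ))) (fun s => ?_) ?_
  · exact Finset.measurable_fun_sum s fun j _ =>
      (hLm.comp (measurable_id.sub_const _)).const_mul _
  · rw [tendsto_pi_nhds]
    exact fun x => (summable_mul_shift hC hL y x).hasSum

/-- Schur's test for the kernel `L(x - j)`: for `p < ∞`, Hölder's inequality with weights
`‖L(x - j)‖` bounds `‖∑_j y_j L(x - j)‖^p` by a constant times `∑_j ‖y_j‖^p ‖L(x - j)‖`, which is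
then integrated in `x` term by term. -/
theorem exists_eLpNorm_tsum_mul_shift_le (hLi : Integrable L) (p : ℝ≥0∞) [Fact (1 ≤ p)]
    (hLm : Measurable L) :
    ∃ K : ℝ≥0∞, K ≠ ∞ ∧ ∀ y : lp (fun _ : ℤ => ℂ) p,
      eLpNorm (fun x : ℝ => ∑' j : ℤ, y j * L (x - (j : ℝ))) p volume ≤ K * ‖y‖ₑ := by
  obtain ⟨B, hB⟩ := exists_summable_and_tsum_norm_shift_le hC hL
  have hp1 : 1 ≤ p := Fact.out
  have hp0 : p ≠ 0 := (zero_lt_one.trans_le hp1).ne'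
  have hw : ∀ x : ℝ, ∑' j : ℤ, ‖L (x - j)‖ₑ ≤ ENNReal.ofReal B := by
    intro x
    simp_rw [← ofReal_norm]
    rw [← ENNReal.ofReal_tsum_of_nonneg (fun _ => norm_nonneg _) (hB x).1]
    exact ENNReal.ofReal_le_ofReal (hB x).2
  have htri : ∀ (y : lp (fun _ : ℤ => ℂ) p) (x : ℝ),
      ‖∑' j : ℤ, y j * L (x - (j : ℝ))‖ₑ ≤ ∑' j : ℤ, ‖L (x - j)‖ₑ * ‖y j‖ₑ := by
    intro y x
    refine (enorm_tsum_le_tsum_enorm).trans_eq (tsum_congr fun j => ?_)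
    rw [enorm_mul, mul_comm]
  rcases eq_or_ne p ∞ with rfl | hpt
  · refine ⟨ENNReal.ofReal B, ENNReal.ofReal_ne_top, fun y => ?_⟩
    rw [eLpNorm_exponent_top]
    refine eLpNormEssSup_le_of_ae_enorm_bound (Eventually.of_forall fun x => ?_)
    refine (htri y x).trans ?_
    calc _ ≤ ∑' j : ℤ, ‖L (x - j)‖ₑ * ‖y‖ₑ := by
          refine ENNReal.tsum_le_tsum fun j => ?_
          gcongr
          exact enorm_le_iff_norm_le.2 (lp.norm_apply_le_norm hp0 y j)
      _ ≤ _ := by rw [ENNReal.tsum_mul_right]; gcongr; exact hw x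
  · set q := p.toReal with hq
    have hq1 : 1 ≤ q := by
      rw [hq, ← ENNReal.toReal_one]; exact ENNReal.toReal_mono hpt hp1
    have hq0 : 0 < q := by linarith
    have hD : ∫⁻ x, ‖L x‖ₑ ≠ ∞ := hLi.2.ne
    have hexp : 0 ≤ 1 - q⁻¹ := by
      have := inv_le_one_of_one_le₀ hq1
      linarith
    refine ⟨ENNReal.ofReal B ^ (1 - q⁻¹) * (∫⁻ x, ‖L x‖ₑ) ^ q⁻¹, ?_, fun y => ?_⟩
    · exact ENNReal.mul_ne_top (ENNReal.rpow_ne_top_of_nonneg hexp ENNReal.ofReal_ne_top)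
        (ENNReal.rpow_ne_top_of_nonneg (by positivity) hD)
    have hpt' : ∀ x : ℝ, ‖∑' j : ℤ, y j * L (x - (j : ℝ))‖ₑ ^ q ≤
        (ENNReal.ofReal B ^ (1 - q⁻¹)) ^ q * ∑' j : ℤ, ‖L (x - j)‖ₑ * ‖y j‖ₑ ^ q := by
      intro x
      have h : ‖∑' j : ℤ, y j * L (x - (j : ℝ))‖ₑ ≤
          ENNReal.ofReal B ^ (1 - q⁻¹) * (∑' j : ℤ, ‖L (x - j)‖ₑ * ‖y j‖ₑ ^ q) ^ q⁻¹ := by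
        refine (htri y x).trans ?_
        rw [ENNReal.tsum_eq_iSup_sum]
        refine iSup_le fun s => ?_
        refine (ENNReal.inner_le_weight_mul_Lp_of_nonneg s hq1 _ _).trans ?_
        gcongr
        · exact (ENNReal.sum_le_tsum s).trans (hw x)
        · exact ENNReal.sum_le_tsum s
      calc _ ≤ (ENNReal.ofReal B ^ (1 - q⁻¹) *
            (∑' j : ℤ, ‖L (x - j)‖ₑ * ‖y j‖ₑ ^ q) ^ q⁻¹) ^ q := by gcongr
        _ = _ := by
          rw [ENNReal.mul_rpow_of_nonneg _ _ hq0.le, ← ENNReal.rpow_mul _ q⁻¹ q,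
            inv_mul_cancel₀ hq0.ne', ENNReal.rpow_one]
    have hy : ∑' j : ℤ, ‖y j‖ₑ ^ q = ‖y‖ₑ ^ q := by
      have hs := lp.hasSum_norm hq0 y
      have h1 : ∀ j : ℤ, ‖y j‖ₑ ^ q = ENNReal.ofReal (‖y j‖ ^ q) := fun j => by
        rw [← ofReal_norm, ENNReal.ofReal_rpow_of_nonneg (norm_nonneg _) hq0.le]
      simp_rw [h1]
      rw [← ENNReal.ofReal_tsum_of_nonneg (fun _ => by positivity) hs.summable, hs.tsum_eq,
        ← ofReal_norm, ENNReal.ofReal_rpow_of_nonneg (norm_nonneg _) hq0.le]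
    have hint : ∫⁻ x : ℝ, ∑' j : ℤ, ‖L (x - j)‖ₑ * ‖y j‖ₑ ^ q =
        (∫⁻ x, ‖L x‖ₑ) * ‖y‖ₑ ^ q := by
      rw [lintegral_tsum fun j => by fun_prop, ← hy, ← ENNReal.tsum_mul_left]
      refine tsum_congr fun j => ?_
      rw [lintegral_mul_const _ (by fun_prop)]
      congr 1
      exact lintegral_sub_right_eq_self (fun x => ‖L x‖ₑ) _
    rw [eLpNorm_eq_lintegral_rpow_enorm_toReal hp0 hpt, ← hq, one_div]
    calc _ ≤ ((ENNReal.ofReal B ^ (1 - q⁻¹)) ^ q * ((∫⁻ x, ‖L x‖ₑ) * ‖y‖ₑ ^ q)) ^ q⁻¹ := by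
          gcongr
          rw [← hint, ← lintegral_const_mul' _ _ (ENNReal.rpow_ne_top_of_nonneg hq0.le
            (ENNReal.rpow_ne_top_of_nonneg hexp ENNReal.ofReal_ne_top))]
          exact lintegral_mono hpt'
      _ = _ := by
          rw [ENNReal.mul_rpow_of_nonneg _ _ (by positivity),
            ENNReal.mul_rpow_of_nonneg _ _ (by positivity), ← ENNReal.rpow_mul _ q q⁻¹,
            ← ENNReal.rpow_mul _ q q⁻¹, mul_inv_cancel₀ hq0.ne', ENNReal.rpow_one,
            ENNReal.rpow_one, mul_assoc]

theorem exists_continuousLinearMap_tsum_mul_shift (hLc : Continuous L) (p : ℝ≥0∞) [Fact (1 ≤ p)] :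
    ∃ T : lp (fun _ : ℤ => ℂ) p →L[ℂ] Lp ℂ p (volume : Measure ℝ),
      ∀ y : lp (fun _ : ℤ => ℂ) p,
        T y =ᵐ[volume] fun x : ℝ => ∑' j : ℤ, y j * L (x - (j : ℝ)) := by
  have hLi : Integrable L := by
    refine (integrable_inv_one_add_sq.const_mul C).mono' hLc.aestronglyMeasurable ?_
    exact Eventually.of_forall fun x => (hL x).trans_eq (div_eq_mul_inv _ _)
  obtain ⟨K, hK, H⟩ := exists_eLpNorm_tsum_mul_shift_le hC hL hLi p hLc.measurable
  have hmem : ∀ y : lp (fun _ : ℤ => ℂ) p,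
      MemLp (fun x : ℝ => ∑' j : ℤ, y j * L (x - (j : ℝ))) p volume := fun y =>
    ⟨(measurable_tsum_mul_shift hC hL hLc.measurable y).aestronglyMeasurable,
      (H y).trans_lt (ENNReal.mul_lt_top hK.lt_top enorm_lt_top)⟩
  let T₀ : lp (fun _ : ℤ => ℂ) p →ₗ[ℂ] Lp ℂ p (volume : Measure ℝ) :=
    { toFun := fun y => (hmem y).toLp _
      map_add' := fun y z => by
        rw [← MemLp.toLp_add (hmem y) (hmem z)]
        refine MemLp.toLp_congr _ _ (Eventually.of_forall fun x => ?_)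
        simp only [Pi.add_apply, lp.coeFn_add, add_mul]
        exact (summable_mul_shift hC hL y x).tsum_add (summable_mul_shift hC hL z x)
      map_smul' := fun a y => by
        rw [RingHom.id_apply, ← MemLp.toLp_const_smul a (hmem y)]
        refine MemLp.toLp_congr _ _ (Eventually.of_forall fun x => ?_)
        simp only [Pi.smul_apply, lp.coeFn_smul, smul_eq_mul, mul_assoc]
        exact tsum_mul_left }
  refine ⟨T₀.mkContinuous K.toReal fun y => ?_, fun y => (hmem y).coeFn_toLp⟩
  change ‖(hmem y).toLp _‖ ≤ _
  rw [Lp.norm_toLp, ← toReal_enorm y, ← ENNReal.toReal_mul]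
  exact ENNReal.toReal_mono (ENNReal.mul_ne_top hK enorm_ne_top) (H y)

end ShiftSeries

/-! ### Even extensions -/

section EvenExtension

variable {c : ℝ} {w w₁ w₂ : ℝ → ℝ}

theorem hasDerivAt_comp_mul_abs {w' ξ : ℝ} (hξ : ξ ≠ 0) (h : HasDerivAt w w' (c * |ξ|)) :
    HasDerivAt (fun ξ => w (c * |ξ|)) (w' * (c * (SignType.sign ξ : ℝ))) ξ :=
  h.comp ξ ((hasDerivAt_abs hξ).const_mul c)

theorem hasDerivAt_comp_mul_abs_mul_sign {w' ξ : ℝ} (hξ : ξ ≠ 0) (h : HasDerivAt w w' (c * |ξ|)) :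
    HasDerivAt (fun ξ => w (c * |ξ|) * (c * (SignType.sign ξ : ℝ))) (w' * c ^ 2) ξ := by
  have hev : ∀ᶠ y in 𝓝 ξ, (SignType.sign y : ℝ) = (SignType.sign ξ : ℝ) := by
    rcases hξ.lt_or_gt with h0 | h0
    · filter_upwards [eventually_lt_nhds h0] with y hy
      rw [sign_neg hy, sign_neg h0]
    · filter_upwards [eventually_gt_nhds h0] with y hy
      rw [sign_pos hy, sign_pos h0]
  have hsq : (SignType.sign ξ : ℝ) * (SignType.sign ξ : ℝ) = 1 := by
    rcases hξ.lt_or_gt with h0 | h0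
    · simp [sign_neg h0]
    · simp [sign_pos h0]
  have h1 := (hasDerivAt_comp_mul_abs hξ h).mul_const (c * (SignType.sign ξ : ℝ))
  convert! h1.congr_of_eventuallyEq (hev.mono fun y hy => ?_) using 1
  · linear_combination (-w' * c ^ 2) * hsq
  · simp only [hy]

variable (hc : 0 < c)

include hc

theorem tendsto_mul_abs_nhdsNE : Tendsto (fun ξ : ℝ => c * |ξ|) (𝓝[{0}ᶜ] 0) (𝓝[>] 0) := by
  refine tendsto_nhdsWithin_iff.2 ⟨?_, ?_⟩
  · have : Continuous fun ξ : ℝ => c * |ξ| := by fun_prop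
    simpa using (this.tendsto 0).mono_left (nhdsWithin_le_nhds (s := {0}ᶜ))
  · filter_upwards [self_mem_nhdsWithin] with ξ hξ
    exact mul_pos hc (abs_pos.2 hξ)

/-- An even extension has no kink at the origin once the derivative tends to zero there. -/
theorem isRegularAlong_comp_mul_abs {a : ℝ} (h₁ : ∀ r, 0 < r → HasDerivAt w (w₁ r) r)
    (h₂ : ∀ r, 0 < r → HasDerivAt w₁ (w₂ r) r) (ha : Tendsto w (𝓝[>] 0) (𝓝 a))
    (hb : Tendsto w₁ (𝓝[>] 0) (𝓝 0)) (hM : w₂ =O[𝓝[>] 0] fun _ => (1 : ℝ)) :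
    IsRegularAlong {0}ᶜ (fun ξ => w (c * |ξ|)) 0 := by
  have ht := tendsto_mul_abs_nhdsNE hc
  have hpos : ∀ ξ ∈ ({0}ᶜ : Set ℝ), 0 < c * |ξ| := fun ξ hξ => mul_pos hc (abs_pos.2 hξ)
  refine IsRegularAlong.of_hasDerivAt isOpen_compl_singleton
    (D := fun ξ => w₁ (c * |ξ|) * (c * (SignType.sign ξ : ℝ)))
    (E := fun ξ => w₂ (c * |ξ|) * c ^ 2) (a := a) (b := 0) ?_ ?_ (ha.comp ht) ?_ ?_
  · filter_upwards [self_mem_nhdsWithin] with ξ hξ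
    exact hasDerivAt_comp_mul_abs hξ (h₁ _ (hpos ξ hξ))
  · filter_upwards [self_mem_nhdsWithin] with ξ hξ
    exact hasDerivAt_comp_mul_abs_mul_sign hξ (h₂ _ (hpos ξ hξ))
  · have h0 : Tendsto (fun ξ => |w₁ (c * |ξ|)| * c) (𝓝[{0}ᶜ] 0) (𝓝 0) := by
      simpa using ((hb.comp ht).abs).mul_const c
    refine squeeze_zero_norm' ?_ h0
    filter_upwards [self_mem_nhdsWithin] with ξ hξ
    have hξ : ξ ≠ 0 := hξ
    have hs : |(SignType.sign ξ : ℝ)| = 1 := by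
      rcases hξ.lt_or_gt with h | h
      · simp [sign_neg h]
      · simp [sign_pos h]
    rw [Real.norm_eq_abs, abs_mul, abs_mul, hs, abs_of_pos hc, mul_one]
  · have := (hM.comp_tendsto ht).mul (Asymptotics.isBigO_refl (fun _ : ℝ => c ^ 2) (𝓝[{0}ᶜ] 0))
    refine this.trans ?_
    exact Asymptotics.isBigO_of_le' (c := ‖c ^ 2‖) _ fun _ => by simp

theorem isCardinalSymbol_comp_mul_abs (hpos : ∀ r, 0 < r → 0 < w r)
    (hC2 : ContDiffOn ℝ 2 w (Ioi 0)) (h₁ : ∀ r, 0 < r → HasDerivAt w (w₁ r) r)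
    (h₂ : ∀ r, 0 < r → HasDerivAt w₁ (w₂ r) r)
    (hdecay : ∃ C, ∀ r, c ≤ r → |w r| ≤ C / r ^ 2 ∧ |w₁ r| ≤ C / r ^ 2 ∧ |w₂ r| ≤ C / r ^ 2)
    (hinv : IsRegularAlong {0}ᶜ (fun ξ => (w (c * |ξ|))⁻¹) 0) :
    IsCardinalSymbol fun ξ => w (c * |ξ|) := by
  have hp : ∀ ξ : ℝ, ξ ≠ 0 → 0 < c * |ξ| := fun ξ hξ => mul_pos hc (abs_pos.2 hξ)
  refine ⟨fun ξ hξ => hpos _ (hp ξ hξ), fun ξ hξ => ?_, ?_, hinv⟩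
  · refine ContDiffAt.contDiffWithinAt ?_
    have hk := hC2.contDiffAt (Ioi_mem_nhds (hp ξ hξ))
    exact hk.comp ξ (contDiffAt_const.mul (contDiffAt_abs hξ))
  · obtain ⟨C, hC⟩ := hdecay
    have hC0 : 0 ≤ C := by
      have h := (abs_nonneg _).trans (hC c le_rfl).1
      by_contra! hneg
      exact absurd h (not_le.2 (div_neg_of_neg_of_pos hneg (by positivity)))
    refine ⟨C * (1 / c ^ 2 + 1 / c + 1), fun ξ hξ => ?_⟩
    have hξ0 : ξ ≠ 0 := by rintro rfl; simp at hξ; linarith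
    have d1 : ∀ y : ℝ, y ≠ 0 → deriv (fun ξ => w (c * |ξ|)) y =
        w₁ (c * |y|) * (c * (SignType.sign y : ℝ)) := fun y hy =>
      (hasDerivAt_comp_mul_abs hy (h₁ _ (hp y hy))).deriv
    have d2 : deriv (deriv fun ξ => w (c * |ξ|)) ξ = w₂ (c * |ξ|) * c ^ 2 := by
      have he : deriv (fun ξ => w (c * |ξ|)) =ᶠ[𝓝 ξ]
          fun y => w₁ (c * |y|) * (c * (SignType.sign y : ℝ)) :=
        (eventually_ne_nhds hξ0).mono fun y hy => d1 y hy
      rw [he.deriv_eq]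
      exact (hasDerivAt_comp_mul_abs_mul_sign hξ0 (h₂ _ (hp ξ hξ0))).deriv
    obtain ⟨b0, b1, b2⟩ := hC (c * |ξ|) (by nlinarith)
    have hs : |(SignType.sign ξ : ℝ)| = 1 := by
      rcases hξ0.lt_or_gt with h | h
      · simp [sign_neg h]
      · simp [sign_pos h]
    have hq : C / (c * |ξ|) ^ 2 = C * (1 / c ^ 2) / ξ ^ 2 := by
      rw [mul_pow, sq_abs]; field_simp
    have t0 : 0 ≤ 1 / c ^ 2 := by positivity
    have t1 : 0 ≤ 1 / c := by positivity
    rw [hq] at b0 b1 b2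
    refine ⟨b0.trans ?_, ?_, ?_⟩
    · gcongr; linarith
    · rw [d1 ξ hξ0, abs_mul, abs_mul, hs, abs_of_pos hc, mul_one]
      calc |w₁ (c * |ξ|)| * c ≤ C * (1 / c ^ 2) / ξ ^ 2 * c := by gcongr
        _ = C * (1 / c) / ξ ^ 2 := by field_simp
        _ ≤ _ := by gcongr; linarith
    · rw [d2, abs_mul, abs_of_pos (by positivity : 0 < c ^ 2)]
      calc |w₂ (c * |ξ|)| * c ^ 2 ≤ C * (1 / c ^ 2) / ξ ^ 2 * c ^ 2 := by gcongr
        _ = C * 1 / ξ ^ 2 := by field_simp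
        _ ≤ _ := by gcongr; linarith

end EvenExtension

/-! ### The multiquadric symbols -/

theorem exists_rpow_mul_besselMoment_le {a : ℝ} (ha : -(1 / 2) < a) (k : ℕ) (s : ℝ) {d : ℝ}
    (hd : 0 < d) : ∃ C : ℝ, 0 ≤ C ∧ ∀ r, d ≤ r → r ^ s * besselMoment a k r ≤ C / r ^ 2 := by
  have ht := tendsto_rpow_mul_exp_neg_mul_atTop_nhds_zero (s + 2) (1 / 2) one_half_pos
  obtain ⟨R, hR⟩ := eventually_atTop.1 (ht.eventually (eventually_le_nhds one_pos))
  obtain ⟨B, hB⟩ := (isCompact_Icc (a := d) (b := R)).exists_bound_of_continuousOn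
    (f := fun r : ℝ => r ^ (s + 2) * Real.exp (-(1 / 2) * r)) (fun r hr => by
      refine ContinuousAt.continuousWithinAt ?_
      refine (ContinuousAt.rpow_const continuousAt_id (Or.inl ?_)).mul (by fun_prop)
      exact (hd.trans_le hr.1).ne')
  have hm := besselMoment_nonneg a k (d / 2)
  have hexp : ∀ r, d ≤ r → r ^ (s + 2) * Real.exp (-(1 / 2) * r) ≤ max 1 B := by
    intro r hr
    rcases le_total R r with h | h
    · exact (hR r h).trans (le_max_left _ _)
    · exact ((le_abs_self _).trans (hB r ⟨hr, h⟩)).trans (le_max_right _ _)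
  refine ⟨max 1 B * besselMoment a k (d / 2), by positivity, fun r hr => ?_⟩
  have hr0 : 0 < r := hd.trans_le hr
  rw [le_div_iff₀ (by positivity)]
  calc r ^ s * besselMoment a k r * r ^ 2
      ≤ r ^ s * (besselMoment a k (d / 2) * Real.exp (-(r / 2))) * r ^ 2 := by
        gcongr; exact besselMoment_le_exp ha k hd hr
    _ = r ^ (s + 2) * Real.exp (-(1 / 2) * r) * besselMoment a k (d / 2) := by
        rw [Real.rpow_add hr0, Real.rpow_two, show -(1 / 2) * r = -(r / 2) by ring]; ring
    _ ≤ _ := by gcongr; exact hexp r hr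

theorem eventually_mem_Ioc_nhdsGT : ∀ᶠ r : ℝ in 𝓝[>] 0, 0 < r ∧ r ≤ 1 :=
  mem_of_superset (Ioc_mem_nhdsGT one_pos) fun _ h => h

theorem tendsto_const_mul_rpow_nhdsGT (C : ℝ) {s : ℝ} (hs : 0 < s) :
    Tendsto (fun r : ℝ => C * r ^ s) (𝓝[>] 0) (𝓝 0) := by
  have h : ContinuousAt (fun r : ℝ => C * r ^ s) 0 :=
    continuousAt_const.mul (Real.continuousAt_rpow_const 0 s (Or.inr hs.le))
  have h' := h.tendsto
  simp only [Real.zero_rpow hs.ne', mul_zero] at h'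
  exact h'.mono_left nhdsWithin_le_nhds

/-- The symbol for positive order `ν = a + 1/2 ≥ 1`. It blows up like `|ξ|^{-2ν}` at the origin, so
its reciprocal vanishes there to order `2ν ≥ 2`, which bounds the second derivative. -/
theorem isCardinalSymbol_besselMoment {a c : ℝ} (ha : 1 / 2 ≤ a) (hc : 0 < c) :
    IsCardinalSymbol fun ξ => besselMoment a 0 (c * |ξ|) := by
  have ha' : -(1 / 2) < a := by linarith
  have hd := fun k r (hr : 0 < r) => hasDerivAt_besselMoment ha' k hr
  have hpos := fun k r (hr : 0 < r) => besselMoment_pos ha' k hr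
  refine isCardinalSymbol_comp_mul_abs hc (w₁ := fun r => -besselMoment a 1 r)
    (w₂ := besselMoment a 2) (hpos 0)
    (contDiffOn_besselMoment ha' 2 0) (hd 0) (fun r hr => ?_) ?_ ?_
  · simpa using! (hd 1 r hr).neg
  · obtain ⟨C0, hC0, H0⟩ := exists_rpow_mul_besselMoment_le ha' 0 0 hc
    obtain ⟨C1, hC1, H1⟩ := exists_rpow_mul_besselMoment_le ha' 1 0 hc
    obtain ⟨C2, hC2, H2⟩ := exists_rpow_mul_besselMoment_le ha' 2 0 hc
    refine ⟨C0 + C1 + C2, fun r hr => ?_⟩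
    have h0 := H0 r hr
    have h1 := H1 r hr
    have h2 := H2 r hr
    rw [Real.rpow_zero, one_mul] at h0 h1 h2
    rw [abs_neg, abs_of_nonneg (besselMoment_nonneg a 0 r),
      abs_of_nonneg (besselMoment_nonneg a 1 r), abs_of_nonneg (besselMoment_nonneg a 2 r)]
    refine ⟨h0.trans ?_, h1.trans ?_, h2.trans ?_⟩ <;> gcongr <;> linarith
  · obtain ⟨C1, hC1, H1⟩ := besselMoment_le_of_le_one ha' 1
    obtain ⟨C2, hC2, H2⟩ := besselMoment_le_of_le_one ha' 2
    set e := Real.exp 3 with he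
    have hinv : ∀ r, 0 < r → r ≤ 1 → (besselMoment a 0 r)⁻¹ ≤ e * r ^ (2 * a + 1) := by
      intro r hr hr1
      have h := le_besselMoment_zero_of_le_one (by linarith : 0 ≤ a) hr hr1
      have h' := inv_anti₀ (by positivity) h
      rwa [mul_inv, Real.exp_neg, inv_inv, Real.rpow_neg hr.le, inv_inv] at h'
    -- The first two derivatives of `1 / M₀`, where `M₀' = -M₁` and `M₁' = -M₂`.
    refine isRegularAlong_comp_mul_abs hc (a := 0) (w := fun r => (besselMoment a 0 r)⁻¹)
      (w₁ := fun r => besselMoment a 1 r * ((besselMoment a 0 r)⁻¹ * (besselMoment a 0 r)⁻¹))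
      (w₂ := fun r => -besselMoment a 2 r * ((besselMoment a 0 r)⁻¹ * (besselMoment a 0 r)⁻¹) +
        2 * (besselMoment a 1 r * besselMoment a 1 r) *
          ((besselMoment a 0 r)⁻¹ * (besselMoment a 0 r)⁻¹ * (besselMoment a 0 r)⁻¹))
      (fun r hr => ?_) (fun r hr => ?_) ?_ ?_ ?_
    · convert! (hd 0 r hr).inv (hpos 0 r hr).ne' using 1
      have := (hpos 0 r hr).ne'
      simp only [zero_add]
      field_simp
    · have h0 := (hd 0 r hr).inv (hpos 0 r hr).ne'
      convert! (hd 1 r hr).mul (h0.mul h0) using 1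
      have := (hpos 0 r hr).ne'
      simp only [Pi.mul_apply, Pi.inv_apply, zero_add, Nat.reduceAdd]
      field_simp
      ring
    · refine squeeze_zero' ?_ ?_ (tendsto_const_mul_rpow_nhdsGT e (s := 2 * a + 1) (by linarith))
      · exact Eventually.of_forall fun r => inv_nonneg.2 (besselMoment_nonneg a 0 r)
      · exact eventually_mem_Ioc_nhdsGT.mono fun r hr => hinv r hr.1 hr.2
    · refine squeeze_zero' ?_ ?_
        (tendsto_const_mul_rpow_nhdsGT (C1 * (e * e)) (s := 2 * a) (by linarith))
      · refine Eventually.of_forall fun r => ?_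
        have := besselMoment_nonneg a 0 r
        have := besselMoment_nonneg a 1 r
        positivity
      · refine eventually_mem_Ioc_nhdsGT.mono fun r ⟨hr, hr1⟩ => ?_
        have i0 := inv_nonneg.2 (besselMoment_nonneg a 0 r)
        calc _ ≤ (C1 * r ^ (-(2 * a + (1 : ℕ) + 1))) *
              ((e * r ^ (2 * a + 1)) * (e * r ^ (2 * a + 1))) := by
              gcongr
              · exact H1 r hr hr1
              · exact hinv r hr hr1
              · exact hinv r hr hr1
          _ = C1 * (e * e) * (r ^ (-(2 * a + (1 : ℕ) + 1)) * r ^ (2 * a + 1) *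
              r ^ (2 * a + 1)) := by ring
          _ = _ := by
            rw [← Real.rpow_add hr, ← Real.rpow_add hr]
            congr 2
            push_cast; ring
    · refine Asymptotics.IsBigO.of_bound (C2 * (e * e) + 2 * (C1 * C1) * (e * e * e)) ?_
      refine eventually_mem_Ioc_nhdsGT.mono fun r ⟨hr, hr1⟩ => ?_
      have i0 := inv_nonneg.2 (besselMoment_nonneg a 0 r)
      have m1 := besselMoment_nonneg a 1 r
      have m2 := besselMoment_nonneg a 2 r
      have hr2 : r ^ (2 * a - 1) ≤ 1 := Real.rpow_le_one hr.le hr1 (by linarith)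
      have hi := hinv r hr hr1
      have b2 : besselMoment a 2 r * ((besselMoment a 0 r)⁻¹ * (besselMoment a 0 r)⁻¹) ≤
          C2 * (e * e) := by
        calc _ ≤ (C2 * r ^ (-(2 * a + (2 : ℕ) + 1))) *
              ((e * r ^ (2 * a + 1)) * (e * r ^ (2 * a + 1))) := by
              gcongr
              exact H2 r hr hr1
          _ = C2 * (e * e) * (r ^ (-(2 * a + (2 : ℕ) + 1)) * r ^ (2 * a + 1) *
              r ^ (2 * a + 1)) := by ring
          _ = C2 * (e * e) * r ^ (2 * a - 1) := by
            rw [← Real.rpow_add hr, ← Real.rpow_add hr]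
            congr 2
            push_cast; ring
          _ ≤ _ := mul_le_of_le_one_right (by positivity) hr2
      have b1 : besselMoment a 1 r * besselMoment a 1 r * ((besselMoment a 0 r)⁻¹ *
          (besselMoment a 0 r)⁻¹ * (besselMoment a 0 r)⁻¹) ≤ C1 * C1 * (e * e * e) := by
        calc _ ≤ (C1 * r ^ (-(2 * a + (1 : ℕ) + 1))) * (C1 * r ^ (-(2 * a + (1 : ℕ) + 1))) *
              ((e * r ^ (2 * a + 1)) * (e * r ^ (2 * a + 1)) * (e * r ^ (2 * a + 1))) := by
              have := H1 r hr hr1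
              gcongr
          _ = C1 * C1 * (e * e * e) * (r ^ (-(2 * a + (1 : ℕ) + 1)) *
              r ^ (-(2 * a + (1 : ℕ) + 1)) * r ^ (2 * a + 1) * r ^ (2 * a + 1) *
              r ^ (2 * a + 1)) := by ring
          _ = C1 * C1 * (e * e * e) * r ^ (2 * a - 1) := by
            rw [← Real.rpow_add hr, ← Real.rpow_add hr, ← Real.rpow_add hr, ← Real.rpow_add hr]
            congr 2
            push_cast; ring
          _ ≤ _ := mul_le_of_le_one_right (by positivity) hr2
      rw [norm_one, mul_one, Real.norm_eq_abs]
      refine (abs_add_le _ _).trans (add_le_add ?_ ?_)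
      · rw [neg_mul, abs_neg, abs_of_nonneg (by positivity)]
        exact b2
      · rw [abs_of_nonneg (by positivity), mul_assoc 2, mul_assoc 2]
        gcongr

/-- The symbol for negative order `-ν`, where `ν = a + 1/2 > 1`. It has a positive limit at the
origin; by the recurrence its derivative is `-2a r^{2a} M`, with `M` the moment of order
`a - 1`, and this vanishes at the origin. -/
theorem isCardinalSymbol_rpow_mul_besselMoment {a c : ℝ} (ha : 1 / 2 < a) (hc : 0 < c) :
    IsCardinalSymbol fun ξ => (c * |ξ|) ^ (2 * a + 1) * besselMoment a 0 (c * |ξ|) := by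
  have ha' : -(1 / 2) < a := by linarith
  have hb' : -(1 / 2) < a - 1 := by linarith
  set H : ℝ → ℝ := fun r => r ^ (2 * a + 1) * besselMoment a 0 r with hH
  set H₁ : ℝ → ℝ := fun r => -(2 * a) * (r ^ (2 * a) * besselMoment (a - 1) 0 r) with hH₁
  set H₂ : ℝ → ℝ := fun r => -(2 * a) * (2 * a * (r ^ (2 * a - 1) * besselMoment (a - 1) 0 r) -
    r ^ (2 * a) * besselMoment (a - 1) 1 r) with hH₂
  have hpos : ∀ r, 0 < r → 0 < H r := fun r hr =>
    mul_pos (by positivity) (besselMoment_pos ha' 0 hr)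
  have hd1 : ∀ r, 0 < r → HasDerivAt H (H₁ r) r := by
    intro r hr
    have h1 := (Real.hasDerivAt_rpow_const (p := 2 * a + 1) (Or.inl hr.ne')).mul
      (hasDerivAt_besselMoment ha' 0 hr)
    convert! h1 using 1
    have h2 := besselMoment_recurrence ha hr
    simp only [hH₁, add_sub_cancel_right, zero_add]
    rw [Real.rpow_add_one hr.ne']
    linear_combination (r ^ (2 * a)) * h2
  have hd2 : ∀ r, 0 < r → HasDerivAt H₁ (H₂ r) r := by
    intro r hr
    have h1 := ((Real.hasDerivAt_rpow_const (p := 2 * a) (Or.inl hr.ne')).mul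
      (hasDerivAt_besselMoment hb' 0 hr)).const_mul (-(2 * a))
    convert! h1 using 1
    simp only [hH₂, zero_add]
    ring
  have n0 := besselMoment_nonneg (a - 1) 0
  have n1 := besselMoment_nonneg (a - 1) 1
  obtain ⟨C0, hC0, B0⟩ := besselMoment_le_of_le_one ha' 0
  obtain ⟨D0, hD0, E0⟩ := besselMoment_le_of_le_one hb' 0
  obtain ⟨D1, hD1, E1⟩ := besselMoment_le_of_le_one hb' 1
  have hreg : IsRegularAlong {0}ᶜ (fun ξ => H (c * |ξ|)) 0 ∧
      ∃ b, b ≠ 0 ∧ Tendsto (fun ξ => H (c * |ξ|)) (𝓝[{0}ᶜ] 0) (𝓝 b) := by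
    have hanti : AntitoneOn H (Ioo 0 1) := by
      refine antitoneOn_of_deriv_nonpos (convex_Ioo 0 1)
        (fun r hr => (hd1 r hr.1).continuousAt.continuousWithinAt)
        (fun r hr => (hd1 r (interior_subset hr).1).differentiableAt.differentiableWithinAt)
        fun r hr => ?_
      have hr0 : 0 < r := (interior_subset hr).1
      rw [(hd1 r hr0).deriv]
      have := n0 r
      have : 0 ≤ 2 * a * (r ^ (2 * a) * besselMoment (a - 1) 0 r) := by positivity
      simp only [hH₁]
      linarith
    have hbdd : BddAbove (H '' Ioo 0 1) := by
      refine ⟨C0, ?_⟩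
      rintro _ ⟨r, hr, rfl⟩
      have hr0 : 0 < r := hr.1
      calc H r ≤ r ^ (2 * a + 1) * (C0 * r ^ (-(2 * a + (0 : ℕ) + 1))) := by
            simp only [hH]; gcongr; exact B0 r hr.1 hr.2.le
        _ = C0 * (r ^ (2 * a + 1) * r ^ (-(2 * a + (0 : ℕ) + 1))) := by ring
        _ = C0 := by
          rw [← Real.rpow_add hr0, Nat.cast_zero, add_zero, add_neg_cancel, Real.rpow_zero, mul_one]
    have hlim := hanti.tendsto_nhdsWithin_Ioo_right (nonempty_Ioo.2 one_pos) hbdd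
    set b := sSup (H '' Ioo 0 1) with hb
    have hb0 : Real.exp (-3) ≤ b := by
      refine ge_of_tendsto hlim (eventually_mem_Ioc_nhdsGT.mono fun r ⟨hr, hr1⟩ => ?_)
      have h := le_besselMoment_zero_of_le_one (by linarith : 0 ≤ a) hr hr1
      calc Real.exp (-3) = r ^ (2 * a + 1) * (Real.exp (-3) * r ^ (-(2 * a + 1))) := by
            rw [mul_left_comm, ← Real.rpow_add hr, add_neg_cancel, Real.rpow_zero, mul_one]
        _ ≤ H r := by simp only [hH]; gcongr
    refine ⟨isRegularAlong_comp_mul_abs hc hd1 hd2 hlim ?_ ?_, b,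
      ((Real.exp_pos _).trans_le hb0).ne', hlim.comp (tendsto_mul_abs_nhdsNE hc)⟩
    · refine squeeze_zero_norm' ?_ (tendsto_const_mul_rpow_nhdsGT (2 * a * D0) one_pos)
      refine eventually_mem_Ioc_nhdsGT.mono fun r ⟨hr, hr1⟩ => ?_
      have := n0 r
      simp only [hH₁]
      rw [neg_mul, norm_neg, Real.norm_of_nonneg (by positivity)]
      calc _ ≤ 2 * a * (r ^ (2 * a) * (D0 * r ^ (-(2 * (a - 1) + (0 : ℕ) + 1)))) := by
            gcongr; exact E0 r hr hr1
        _ = 2 * a * D0 * (r ^ (2 * a) * r ^ (-(2 * (a - 1) + (0 : ℕ) + 1))) := by ring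
        _ = _ := by
          rw [← Real.rpow_add hr]
          congr 2
          push_cast; ring
    · refine Asymptotics.IsBigO.of_bound (2 * a * (2 * a * D0 + D1)) ?_
      refine eventually_mem_Ioc_nhdsGT.mono fun r ⟨hr, hr1⟩ => ?_
      have := n0 r
      have := n1 r
      have g0 : r ^ (2 * a - 1) * besselMoment (a - 1) 0 r ≤ D0 := by
        calc _ ≤ r ^ (2 * a - 1) * (D0 * r ^ (-(2 * (a - 1) + (0 : ℕ) + 1))) := by
              gcongr; exact E0 r hr hr1
          _ = D0 * (r ^ (2 * a - 1) * r ^ (-(2 * (a - 1) + (0 : ℕ) + 1))) := by ring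
          _ = D0 * r ^ (0 : ℝ) := by
            rw [← Real.rpow_add hr]
            congr 2
            push_cast; ring
          _ = D0 := by rw [Real.rpow_zero, mul_one]
      have g1 : r ^ (2 * a) * besselMoment (a - 1) 1 r ≤ D1 := by
        calc _ ≤ r ^ (2 * a) * (D1 * r ^ (-(2 * (a - 1) + (1 : ℕ) + 1))) := by
              gcongr; exact E1 r hr hr1
          _ = D1 * (r ^ (2 * a) * r ^ (-(2 * (a - 1) + (1 : ℕ) + 1))) := by ring
          _ = D1 * r ^ (0 : ℝ) := by
            rw [← Real.rpow_add hr]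
            congr 2
            push_cast; ring
          _ = D1 := by rw [Real.rpow_zero, mul_one]
      simp only [hH₂]
      rw [norm_one, mul_one, neg_mul, norm_neg, Real.norm_eq_abs, abs_mul,
        abs_of_pos (by linarith : 0 < 2 * a)]
      gcongr
      refine (abs_sub _ _).trans (add_le_add ?_ ?_)
      · rw [abs_of_nonneg (by positivity)]; gcongr
      · rw [abs_of_nonneg (by positivity)]; exact g1
  obtain ⟨hreg, b, hb0, hb⟩ := hreg
  refine isCardinalSymbol_comp_mul_abs hc (w := H) hpos ?_ hd1 hd2 ?_
    (hreg.inv isOpen_compl_singleton hb hb0)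
  · refine ContDiffOn.mul (fun r hr => ?_) (contDiffOn_besselMoment ha' 2 0)
    exact (Real.contDiffAt_rpow_const_of_ne (ne_of_gt hr)).contDiffWithinAt
  · obtain ⟨K0, hK0, F0⟩ := exists_rpow_mul_besselMoment_le ha' 0 (2 * a + 1) hc
    obtain ⟨K1, hK1, F1⟩ := exists_rpow_mul_besselMoment_le hb' 0 (2 * a) hc
    obtain ⟨K2, hK2, F2⟩ := exists_rpow_mul_besselMoment_le hb' 0 (2 * a - 1) hc
    obtain ⟨K3, hK3, F3⟩ := exists_rpow_mul_besselMoment_le hb' 1 (2 * a) hc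
    refine ⟨K0 + 2 * a * K1 + 2 * a * (2 * a * K2 + K3), fun r hr => ?_⟩
    have hr0 : 0 < r := hc.trans_le hr
    have := n0 r
    have := n1 r
    have := besselMoment_nonneg a 0 r
    have q1 : 0 ≤ 2 * a * K1 := by positivity
    have q2 : 0 ≤ 2 * a * (2 * a * K2 + K3) := by positivity
    refine ⟨?_, ?_, ?_⟩
    · rw [abs_of_pos (hpos r hr0)]
      refine (F0 r hr).trans ?_
      gcongr; linarith
    · simp only [hH₁]
      rw [neg_mul, abs_neg, abs_of_nonneg (by positivity)]
      calc _ ≤ 2 * a * (K1 / r ^ 2) := by gcongr; exact F1 r hr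
        _ = 2 * a * K1 / r ^ 2 := by ring
        _ ≤ _ := by gcongr; linarith
    · simp only [hH₂]
      rw [neg_mul, abs_neg, abs_mul, abs_of_pos (by linarith : 0 < 2 * a)]
      calc _ ≤ 2 * a * (2 * a * (K2 / r ^ 2) + K3 / r ^ 2) := by
            gcongr
            refine (abs_sub _ _).trans (add_le_add ?_ ?_)
            · rw [abs_of_nonneg (by positivity)]; gcongr; exact F2 r hr
            · rw [abs_of_nonneg (by positivity)]; exact F3 r hr
        _ = 2 * a * (2 * a * K2 + K3) / r ^ 2 := by ring
        _ ≤ _ := by gcongr; linarith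

/-! ### The fundamental function -/

theorem besselK_eq_besselMoment (ν r : ℝ) : besselK ν r =
    Real.Gamma (1 / 2) * r ^ |ν| / ((2 : ℝ) ^ |ν| * Real.Gamma (|ν| + 1 / 2)) *
      besselMoment (|ν| - 1 / 2) 0 r := by
  simp [besselK, besselMoment]

theorem div_rpow_mul_mul_rpow {c t : ℝ} (hc : 0 < c) (ht : 0 < t) (s : ℝ) :
    (c / t) ^ s * (c * t) ^ s = c ^ (2 * s) := by
  rw [← Real.mul_rpow (by positivity) (by positivity), Real.rpow_mul hc.le, Real.rpow_two]
  congr 1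
  field_simp

/-- Up to a nonzero constant, which cancels in `fundamentalFT`, the transform of the multiquadric is
one of the two symbols above. -/
theorem exists_isCardinalSymbol_multiquadricFT {α c : ℝ}
    (hα : α ∈ Iio (-(3 / 2) : ℝ) ∪ (Ici (1 / 2 : ℝ) \ range (fun n : ℕ => (n : ℝ))))
    (hc : 0 < c) : ∃ (f : ℝ → ℝ) (ρ : ℝ), IsCardinalSymbol f ∧ ρ ≠ 0 ∧
      ∀ ξ, ξ ≠ 0 → multiquadricFT α c ξ = ρ * f ξ := by
  have hΓ : Real.Gamma (-α) ≠ 0 := by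
    refine Real.Gamma_ne_zero fun m hm => ?_
    have hm' : α = m := by linarith
    rcases hα with h | h
    · have h : α < -(3 / 2) := h
      have : (0 : ℝ) ≤ m := m.cast_nonneg
      linarith
    · exact h.2 ⟨m, hm'.symm⟩
  have hΓ2 : Real.Gamma (1 / 2) ≠ 0 := (Real.Gamma_pos_of_pos one_half_pos).ne'
  have hΓ3 : Real.Gamma (|α + 1 / 2| + 1 / 2) ≠ 0 :=
    (Real.Gamma_pos_of_pos (by positivity)).ne'
  rcases hα with h | h
  · have h : α < -(3 / 2) := h
    have habs : |α + 1 / 2| = -(α + 1 / 2) := abs_of_neg (by linarith)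
    refine ⟨_, (2 : ℝ) ^ (1 + α) / Real.Gamma (-α) * (Real.Gamma (1 / 2) /
      ((2 : ℝ) ^ |α + 1 / 2| * Real.Gamma (|α + 1 / 2| + 1 / 2))) * c ^ (2 * (α + 1 / 2)),
      isCardinalSymbol_rpow_mul_besselMoment (a := -α - 1) (by linarith) hc, by positivity,
      fun ξ hξ => ?_⟩
    have hx : 0 < |ξ| := abs_pos.2 hξ
    have key : (c / |ξ|) ^ (α + 1 / 2) * (c * |ξ|) ^ (-(α + 1 / 2)) =
        c ^ (2 * (α + 1 / 2)) * (c * |ξ|) ^ (2 * (-α - 1) + 1) := by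
      rw [show 2 * (-α - 1) + 1 = -(α + 1 / 2) - (α + 1 / 2) by ring,
        Real.rpow_sub (mul_pos hc hx), ← div_rpow_mul_mul_rpow hc hx]
      field_simp
    rw [multiquadricFT, besselK_eq_besselMoment, habs,
      show -(α + 1 / 2) - 1 / 2 = -α - 1 by ring]
    linear_combination ((2 : ℝ) ^ (1 + α) / Real.Gamma (-α) * (Real.Gamma (1 / 2) /
      ((2 : ℝ) ^ (-(α + 1 / 2)) * Real.Gamma (-(α + 1 / 2) + 1 / 2))) *
      besselMoment (-α - 1) 0 (c * |ξ|)) * key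
  · have h : 1 / 2 ≤ α := h.1
    have habs : |α + 1 / 2| = α + 1 / 2 := abs_of_pos (by linarith)
    refine ⟨_, (2 : ℝ) ^ (1 + α) / Real.Gamma (-α) * (Real.Gamma (1 / 2) /
      ((2 : ℝ) ^ |α + 1 / 2| * Real.Gamma (|α + 1 / 2| + 1 / 2))) * c ^ (2 * (α + 1 / 2)),
      isCardinalSymbol_besselMoment h hc, by positivity, fun ξ hξ => ?_⟩
    have hx : 0 < |ξ| := abs_pos.2 hξ
    have key : (c / |ξ|) ^ (α + 1 / 2) * (c * |ξ|) ^ (α + 1 / 2) = c ^ (2 * (α + 1 / 2)) :=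
      div_rpow_mul_mul_rpow hc hx _
    rw [multiquadricFT, besselK_eq_besselMoment, habs, add_sub_cancel_right]
    linear_combination ((2 : ℝ) ^ (1 + α) / Real.Gamma (-α) * (Real.Gamma (1 / 2) /
      ((2 : ℝ) ^ (α + 1 / 2) * Real.Gamma (α + 1 / 2 + 1 / 2))) *
      besselMoment α 0 (c * |ξ|)) * key

theorem fundamentalFT_eq_div_periodization {α c ρ : ℝ} {f : ℝ → ℝ} (hρ : ρ ≠ 0)
    (h : ∀ ξ, ξ ≠ 0 → multiquadricFT α c ξ = ρ * f ξ) {ξ : ℝ} (hξ : ξ ∈ nonPeriods) :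
    fundamentalFT α c ξ = f ξ / periodization f ξ := by
  have hs : ∑' j : ℤ, multiquadricFT α c (ξ + 2 * Real.pi * (j : ℝ)) = ρ * periodization f ξ := by
    rw [periodization, ← tsum_mul_left]
    exact tsum_congr fun j => h _ (nonPeriods_subset (add_mem_nonPeriods hξ j))
  rw [fundamentalFT, hs, h ξ (nonPeriods_subset hξ), mul_div_mul_left _ _ hρ]

theorem continuous_and_decay_fundamentalFunction {α c : ℝ}
    (hα : α ∈ Iio (-(3 / 2) : ℝ) ∪ (Ici (1 / 2 : ℝ) \ range (fun n : ℕ => (n : ℝ))))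
    (hc : 0 < c) : Continuous (fundamentalFunction α c) ∧
      ∃ C : ℝ, 0 ≤ C ∧ ∀ x, ‖fundamentalFunction α c x‖ ≤ C / (1 + x ^ 2) := by
  obtain ⟨f, ρ, hf, hρ, h⟩ := exists_isCardinalSymbol_multiquadricFT hα hc
  have hae : ∀ᵐ ξ : ℝ, fundamentalFT α c ξ = f ξ / periodization f ξ := by
    have := countable_compl_nonPeriods.ae_notMem (volume : Measure ℝ)
    filter_upwards [this] with ξ hξ
    exact fundamentalFT_eq_div_periodization hρ h (not_not.1 hξ)
  have heq : fundamentalFunction α c = fun x : ℝ => 1 / (2 * (Real.pi : ℂ)) *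
      ∫ ξ : ℝ, ((f ξ / periodization f ξ : ℝ) : ℂ) *
        Complex.exp (Complex.I * (x : ℂ) * (ξ : ℂ)) := by
    funext x
    rw [fundamentalFunction]
    congr 1
    refine integral_congr_ae ?_
    filter_upwards [hae] with ξ hξ
    rw [hξ]
  have hint := hf.integrable_div_periodization
  constructor
  · rw [heq]
    refine continuous_const.mul (continuous_of_dominated
      (bound := fun ξ => |f ξ / periodization f ξ|) (fun x => ?_) (fun x => ?_) hint.abs ?_)
    · exact hint.ofReal.aestronglyMeasurable.mul (by fun_prop)
    · refine Eventually.of_forall fun ξ => ?_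
      rw [norm_mul, Complex.norm_real, Real.norm_eq_abs,
        show Complex.I * (x : ℂ) * (ξ : ℂ) = ((x * ξ : ℝ) : ℂ) * Complex.I by push_cast; ring,
        Complex.norm_exp_ofReal_mul_I, mul_one]
    · exact Eventually.of_forall fun ξ => by fun_prop
  · obtain ⟨C, hC0, hC⟩ := hf.exists_norm_fourierIntegral_div_periodization_le
    refine ⟨‖1 / (2 * (Real.pi : ℂ))‖ * C, by positivity, fun x => ?_⟩
    rw [heq, norm_mul, mul_div_assoc]
    gcongr
    exact hC x

end CardinalInterpolation

theorem mainTheorem7 (α c : ℝ)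
    (hα : α ∈ Iio (-(3 / 2) : ℝ) ∪ (Ici (1 / 2 : ℝ) \ range (fun n : ℕ => (n : ℝ))))
    (hc : 0 < c) (p : ℝ≥0∞) [Fact (1 ≤ p)] :
    (∀ (y : lp (fun _ : ℤ => ℂ) p) (x : ℝ),
      Summable fun j : ℤ => y j * CardinalInterpolation.fundamentalFunction α c (x - (j : ℝ))) ∧
    ∃ T : lp (fun _ : ℤ => ℂ) p →L[ℂ] Lp ℂ p (volume : Measure ℝ),
      ∀ y : lp (fun _ : ℤ => ℂ) p,
        T y =ᵐ[volume] CardinalInterpolation.cardinalInterpolant α c (fun j => y j) := by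
  obtain ⟨hcont, C, hC, hdecay⟩ :=
    CardinalInterpolation.continuous_and_decay_fundamentalFunction hα hc
  exact ⟨fun y x => CardinalInterpolation.summable_mul_shift hC hdecay y x,
    CardinalInterpolation.exists_continuousLinearMap_tsum_mul_shift hC hdecay hcont p⟩
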